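/- Setting. Let $(\overline M,\overline g)$ be a smooth finite-dimensional semi-Riemannian manifold ($\overline g$ smooth, symmetric, nondegenerate, of constant index) of constant sectional curvature $c$, with Levi-Civita connection $\overline\nabla$. Let $M$ be a smooth manifold with $\dim M=\dim\overline M-1$, immersed in $\overline M$, such that the radical $\mathrm{Rad}\,TM=TM\cap TM^{\perp}$ of the induced metric $g$ is a smooth distribution of rank one; that is, $(M,g)$ is a lightlike hypersurface. (Manifolds are Hausdorff and without boundary.) A *screen distribution* is a smooth distribution $S(TM)$ with $TM=\mathrm{Rad}\,TM\oplus S(TM)$. A *normalizing pair* of $S(TM)$ is a pair $(\xi,N)$ with $\xi\in\mathrm{Rad}\,TM$, $\overline g(N,\xi)=1$, $\overline g(N,N)=0$ and $\overline g(N,s)=0$ for all $s\in S(TM)$; the vectors $N$ span a line bundle $\mathrm{tr}(TM)$ along $M$ with $T\overline M|_M=TM\oplus \mathrm{tr}(TM)$. For $X,Y\in\Gamma(TM)$, the induced connection $\nabla_XY$ is the component of $\overline\nabla_XY$ in $TM$, and $A_NX$ is minus the component of $\overline\nabla_XN$ in $TM$. The vector field $A_N\xi$ depends only on $S(TM)$,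 not on the normalizing pair. Put $R(X,Y)=\nabla_X\nabla_Y-\nabla_Y\nabla_X-\nabla_{[X,Y]}$ and $R(X,Y,Z,W)=g(R(X,Y)Z,W)$. The screen is *admissible* if $R$ is an algebraic curvature tensor: $$R(X,Y,Z,W)=-R(Y,X,Z,W)=R(Z,W,X,Y),\qquad R(X,Y,Z,W)+R(Y,Z,X,W)+R(Z,X,Y,W)=0 .$$ For an admissible screen and $x\in T_uM$ with $g(x,x)=\pm1$, the pseudo-Jacobi operator $J_R(x):T_uM\to T_uM$ is defined by $\tilde g(J_R(x)y,w)=R(y,x,x,w)$ for all $y,w\in T_uM$, where $\tilde g(y,w)=g(y,w)+\overline g(N,y)\,\overline g(N,w)$ is nondegenerate. $M$ is spacelike (resp. timelike) Osserman at $u$ if for each admissible screen the characteristic polynomial of $J_R(x)$ is the same for all $x\in T_uM$ with $g(x,x)=1$ (resp. $g(x,x)=-1$), and *pointwise Osserman* if at each point $u$ it is spacelike or timelike Osserman. Statement. Let $(M,g)$ be a pointwise Osserman lightlike hypersurface of $(\overline M,\overline g)$ as above, and let $S(TM)$ be an admissible screen distribution for which the vector field $A_N\xi$ is nowhere null, i.e.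 $g(A_N\xi,A_N\xi)\neq0$ at every point of $M$. Then $(M,g,S(TM))$ is locally symmetric, i.e. $$(\nabla_WR)(X,Y)Z=0\qquad\text{for all }W,X,Y,Z\in\Gamma(TM),$$ if and only if it is semi-symmetric, i.e. for all $V_1,V_2,X,Y,Z,T\in\Gamma(TM)$, $$(R(V_1,V_2)\cdot R)(X,Y,Z,T):=-R(R(V_1,V_2)X,Y,Z,T)-R(X,R(V_1,V_2)Y,Z,T)-R(X,Y,R(V_1,V_2)Z,T)-R(X,Y,Z,R(V_1,V_2)T)=0 .$$ -/

import Mathlib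

open scoped Manifold ContDiff Bundle

noncomputable section

namespace LightlikeGeometry

variable {E : Type*} [NormedAddCommGroup E] [NormedSpace ℝ E]
  {M : Type*} [TopologicalSpace M] [ChartedSpace E M]
  {F : Type*} [NormedAddCommGroup F] [NormedSpace ℝ F]
  {N : Type*} [TopologicalSpace N] [ChartedSpace F N]

instance instFiniteDimensionalTangentSpace [FiniteDimensional ℝ E] (u : M) :
    FiniteDimensional ℝ (TangentSpace 𝓘(ℝ, E) u) :=
  inferInstanceAs (FiniteDimensional ℝ E)

/-- A (not necessarily continuous) vector field on `M`. -/
abbrev VField (E : Type*) [NormedAddCommGroup E] [NormedSpace ℝ E]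
    (M : Type*) [TopologicalSpace M] [ChartedSpace E M] : Type _ :=
  Π u : M, TangentSpace 𝓘(ℝ, E) u

/-- The vector field `X` is smooth on the set `U`. -/
def SmoothFieldOn [IsManifold 𝓘(ℝ, E) ∞ M] (X : VField E M) (U : Set M) : Prop :=
  ContMDiffOn 𝓘(ℝ, E) 𝓘(ℝ, E).tangent ∞ (fun u => (⟨u, X u⟩ : TangentBundle 𝓘(ℝ, E) M)) U

/-- `X ∈ Γ(TM)`: the vector field `X` is smooth on all of `M`. -/
def SmoothField [IsManifold 𝓘(ℝ, E) ∞ M] (X : VField E M) : Prop :=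
  ContMDiff 𝓘(ℝ, E) 𝓘(ℝ, E).tangent ∞ (fun u => (⟨u, X u⟩ : TangentBundle 𝓘(ℝ, E) M))

/-- The curvature operator `R(X,Y)Z = D_X D_Y Z - D_Y D_X Z - D_[X,Y] Z` of an operator
`D X Y = D_X Y` on vector fields. -/
def curvatureOp (D : VField E M → VField E M → VField E M) (X Y Z : VField E M) : VField E M :=
  D X (D Y Z) - D Y (D X Z) - D (VectorField.mlieBracket 𝓘(ℝ, E) X Y) Z

/-! ### The ambient semi-Riemannian manifold -/

/-- The bilinear form underlying a continuous bilinear form on a tangent space. -/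
def toBilin {p : N}
    (b : TangentSpace 𝓘(ℝ, F) p →L[ℝ] TangentSpace 𝓘(ℝ, F) p →L[ℝ] ℝ) :
    LinearMap.BilinForm ℝ (TangentSpace 𝓘(ℝ, F) p) :=
  LinearMap.mk₂ ℝ (fun v w => b v w) (by simp) (by simp) (by simp) (by simp)

/-- A semi-Riemannian metric: a smooth, symmetric, nondegenerate `(0,2)`-tensor field of constant
index (the index at `p` is the largest dimension of a negative definite subspace of `T_p N`). -/
structure SemiRiemannianMetric (F : Type*) [NormedAddCommGroup F] [NormedSpace ℝ F]
    (N : Type*) [TopologicalSpace N] [ChartedSpace F N] [IsManifold 𝓘(ℝ, F) ∞ N] where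
  val (p : N) : TangentSpace 𝓘(ℝ, F) p →L[ℝ] TangentSpace 𝓘(ℝ, F) p →L[ℝ] ℝ
  symm (p : N) (v w : TangentSpace 𝓘(ℝ, F) p) : val p v w = val p w v
  nondegenerate (p : N) (v : TangentSpace 𝓘(ℝ, F) p) : (∀ w, val p v w = 0) → v = 0
  constant_index (p q : N) :
    sigNeg (LinearMap.BilinMap.toQuadraticMap (toBilin (val p))) =
      sigNeg (LinearMap.BilinMap.toQuadraticMap (toBilin (val q)))
  contMDiff : ContMDiff 𝓘(ℝ, F) (𝓘(ℝ, F).prod 𝓘(ℝ, F →L[ℝ] F →L[ℝ] ℝ)) ∞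
    (fun p => Bundle.TotalSpace.mk' (F →L[ℝ] F →L[ℝ] ℝ)
      (E := fun p : N => TangentSpace 𝓘(ℝ, F) p →L[ℝ] TangentSpace 𝓘(ℝ, F) p →L[ℝ] ℝ)
      p (val p))

/-- A linear connection on the tangent bundle of `N`; `D Y p (X p)` is `(D_X Y)(p)`. -/
abbrev Connection (F : Type*) [NormedAddCommGroup F] [NormedSpace ℝ F]
    (N : Type*) [TopologicalSpace N] [ChartedSpace F N] [IsManifold 𝓘(ℝ, F) ∞ N] : Type _ :=
  CovariantDerivative 𝓘(ℝ, F) F (TangentSpace 𝓘(ℝ, F) : N → Type _)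

/-- `D` is the Levi-Civita connection of `g`: the (smooth) linear connection which is torsion-free
and for which `g` is parallel. -/
structure IsLeviCivita [FiniteDimensional ℝ F] [IsManifold 𝓘(ℝ, F) ∞ N]
    (g : SemiRiemannianMetric F N) (D : Connection F N) : Prop where
  smooth : CovariantDerivative.ContMDiffCovariantDerivative D ∞
  torsion_eq_zero : D.torsion = 0
  metric (Y Z : VField F N) (p : N)
    (hY : MDifferentiableAt 𝓘(ℝ, F) 𝓘(ℝ, F).tangent
      (fun q => (⟨q, Y q⟩ : TangentBundle 𝓘(ℝ, F) N)) p)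
    (hZ : MDifferentiableAt 𝓘(ℝ, F) 𝓘(ℝ, F).tangent
      (fun q => (⟨q, Z q⟩ : TangentBundle 𝓘(ℝ, F) N)) p)
    (v : TangentSpace 𝓘(ℝ, F) p) :
    mvfderiv 𝓘(ℝ, F) (fun q => g.val q (Y q) (Z q)) p v =
      g.val p (D Y p v) (Z p) + g.val p (Y p) (D Z p v)

/-- Constant sectional curvature `c`: the sectional curvature
`g(R(X,Y)Y,X) / (g(X,X) g(Y,Y) - g(X,Y)²)` of every nondegenerate tangent plane equals `c`. -/
def HasConstantSectionalCurvature [IsManifold 𝓘(ℝ, F) ∞ N]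
    (g : SemiRiemannianMetric F N) (D : Connection F N) (c : ℝ) : Prop :=
  ∀ X Y : VField F N, SmoothField X → SmoothField Y → ∀ p : N,
    g.val p (X p) (X p) * g.val p (Y p) (Y p) - g.val p (X p) (Y p) ^ 2 ≠ 0 →
    g.val p (curvatureOp (fun V W q => D W q (V q)) X Y Y p) (X p) /
      (g.val p (X p) (X p) * g.val p (Y p) (Y p) - g.val p (X p) (Y p) ^ 2) = c

/-- The covariant derivative `D_x V` along `f : M → N` of a vector field `V` along `f`, in the
direction `x ∈ T_u M`. In a trivialization of `TN` around `f u`, the first term differentiates the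
components of `V`; the second one is the derivative in the direction `df(x)` of the vector field on
`N` whose components are constant, with value `V u` at `f u`. Thus `D_x (Y ∘ f) = D_{df(x)} Y`. -/
def covAlong [IsManifold 𝓘(ℝ, F) ∞ N] (D : Connection F N) (f : M → N)
    (V : Π u : M, TangentSpace 𝓘(ℝ, F) (f u)) (u : M) (x : TangentSpace 𝓘(ℝ, E) u) :
    TangentSpace 𝓘(ℝ, F) (f u) :=
  (trivializationAt F (TangentSpace 𝓘(ℝ, F) : N → Type _) (f u)).symm (f u)
      (mvfderiv 𝓘(ℝ, E) (fun u' : M =>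
        (trivializationAt F (TangentSpace 𝓘(ℝ, F) : N → Type _) (f u) ⟨f u', V u'⟩).2) u x) +
    D (FiberBundle.extend F (V u)) (f u) (mfderiv 𝓘(ℝ, E) 𝓘(ℝ, F) f u x)

/-! ### Lightlike hypersurfaces and screens -/

section Hypersurface

variable [IsManifold 𝓘(ℝ, E) ∞ M] [IsManifold 𝓘(ℝ, F) ∞ N]

/-- The metric `g` induced on `M` by `f : M → N`. -/
def indMetric (g : SemiRiemannianMetric F N) (f : M → N) (u : M)
    (x y : TangentSpace 𝓘(ℝ, E) u) : ℝ :=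
  g.val (f u) (mfderiv 𝓘(ℝ, E) 𝓘(ℝ, F) f u x) (mfderiv 𝓘(ℝ, E) 𝓘(ℝ, F) f u y)

/-- The radical `Rad T_u M = {x ∈ T_u M | g(x, y) = 0 for all y ∈ T_u M}`. -/
def radical (g : SemiRiemannianMetric F N) (f : M → N) (u : M) :
    Submodule ℝ (TangentSpace 𝓘(ℝ, E) u) where
  carrier := {x | ∀ y, indMetric g f u x y = 0}
  add_mem' := by
    intro a b ha hb y
    have h1 := ha y
    have h2 := hb y
    simp only [indMetric] at h1 h2 ⊢
    simp [h1, h2]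
  zero_mem' := by
    intro y
    simp [indMetric]
  smul_mem' := by
    intro c a ha y
    have h1 := ha y
    simp only [indMetric] at h1 ⊢
    simp [h1]

/-- `S` is a smooth distribution of rank `k` on `M`: locally it has a smooth frame. -/
def IsSmoothDistribution (k : ℕ) (S : Π u : M, Submodule ℝ (TangentSpace 𝓘(ℝ, E) u)) : Prop :=
  ∀ u₀ : M, ∃ U : Set M, IsOpen U ∧ u₀ ∈ U ∧ ∃ X : Fin k → VField E M,
    (∀ i, SmoothFieldOn (X i) U) ∧
    ∀ u ∈ U, LinearIndependent ℝ (fun i => X i u) ∧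
      Submodule.span ℝ (Set.range fun i => X i u) = S u

/-- `f : M → N` is a lightlike hypersurface: an immersion of codimension one, the radical of whose
induced metric is a smooth distribution of rank one. -/
structure IsLightlikeHypersurface (g : SemiRiemannianMetric F N) (f : M → N) : Prop where
  smooth : ContMDiff 𝓘(ℝ, E) 𝓘(ℝ, F) ∞ f
  immersion (u : M) : Function.Injective (mfderiv 𝓘(ℝ, E) 𝓘(ℝ, F) f u)
  codim_one : Module.finrank ℝ F = Module.finrank ℝ E + 1
  radical_rank_one : IsSmoothDistribution 1 (fun u : M => radical (E := E) g f u)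

/-- `S` is a screen distribution: a smooth distribution complementary to the radical. (The induced
metric is then automatically nondegenerate on `S`.) -/
def IsScreen (g : SemiRiemannianMetric F N) (f : M → N)
    (S : Π u : M, Submodule ℝ (TangentSpace 𝓘(ℝ, E) u)) : Prop :=
  (∃ k, IsSmoothDistribution k S) ∧ ∀ u, IsCompl (radical g f u) (S u)

variable (g : SemiRiemannianMetric F N) (D : Connection F N) (f : M → N)
  (S : Π u : M, Submodule ℝ (TangentSpace 𝓘(ℝ, E) u))

/-- `(ξ, n)` is a normalizing pair at `u`: `ξ ∈ Rad T_u M`, and `n` is a lightlike vector orthogonal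
to the screen with `g(n, ξ) = 1`. -/
structure IsNormalizingPairAt (u : M) (ξ : TangentSpace 𝓘(ℝ, E) u)
    (n : TangentSpace 𝓘(ℝ, F) (f u)) : Prop where
  mem_radical : ξ ∈ radical g f u
  pairing : g.val (f u) n (mfderiv 𝓘(ℝ, E) 𝓘(ℝ, F) f u ξ) = 1
  null : g.val (f u) n n = 0
  orthogonal (s : TangentSpace 𝓘(ℝ, E) u) (hs : s ∈ S u) :
    g.val (f u) n (mfderiv 𝓘(ℝ, E) 𝓘(ℝ, F) f u s) = 0

/-- The fibre `tr(TM)_u = ltr(TM)_u` of the lightlike transversal line bundle of the screen. -/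
def transversal (u : M) : Submodule ℝ (TangentSpace 𝓘(ℝ, F) (f u)) :=
  Submodule.span ℝ {n | ∃ ξ, IsNormalizingPairAt g f S u ξ n}

/-- The tangential part of `w` in `T_{f u} N = df(T_u M) ⊕ tr(TM)_u`: the unique `x ∈ T_u M` with
`w - df(x) ∈ tr(TM)_u`. -/
def tanPart (u : M) (w : TangentSpace 𝓘(ℝ, F) (f u)) : TangentSpace 𝓘(ℝ, E) u :=
  Classical.epsilon fun x => w - mfderiv 𝓘(ℝ, E) 𝓘(ℝ, F) f u x ∈ transversal g f S u

/-- The induced connection `∇_X Y`: the tangential part of the ambient derivative of `Y` (Gauss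
formula). -/
def indConn (X Y : VField E M) : VField E M := fun u =>
  tanPart g f S u
    (covAlong D f (fun u' => mfderiv 𝓘(ℝ, E) 𝓘(ℝ, F) f u' (Y u')) u (X u))

/-- The shape operator `A_V` of a field `V` along `f`: `-A_V x` is the tangential part of the
ambient derivative of `V` (Weingarten formula). -/
def shapeOp (V : Π u : M, TangentSpace 𝓘(ℝ, F) (f u)) (u : M) (x : TangentSpace 𝓘(ℝ, E) u) :
    TangentSpace 𝓘(ℝ, E) u :=
  -tanPart g f S u (covAlong D f V u x)

/-- The induced curvature operator `R(X,Y)Z` of `(M, g, S)`. -/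
def indCurv (X Y Z : VField E M) : VField E M :=
  curvatureOp (indConn g D f S) X Y Z

/-- The induced `(0,4)` curvature tensor `R(X,Y,Z,W) = g(R(X,Y)Z, W)`. -/
def indCurv4 (X Y Z W : VField E M) : M → ℝ := fun u =>
  indMetric g f u (indCurv g D f S X Y Z u) (W u)

/-- The screen distribution `S` is admissible: its induced curvature tensor is an algebraic
curvature tensor. -/
structure IsAdmissible : Prop where
  isScreen : IsScreen g f S
  antisymm (X Y Z W : VField E M) (hX : SmoothField X) (hY : SmoothField Y)
    (hZ : SmoothField Z) (hW : SmoothField W) :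
    indCurv4 g D f S X Y Z W = -indCurv4 g D f S Y X Z W
  pair_symm (X Y Z W : VField E M) (hX : SmoothField X) (hY : SmoothField Y)
    (hZ : SmoothField Z) (hW : SmoothField W) :
    indCurv4 g D f S X Y Z W = indCurv4 g D f S Z W X Y
  bianchi (X Y Z W : VField E M) (hX : SmoothField X) (hY : SmoothField Y)
    (hZ : SmoothField Z) (hW : SmoothField W) :
    indCurv4 g D f S X Y Z W + indCurv4 g D f S Y Z X W + indCurv4 g D f S Z X Y W = 0

/-- The nondegenerate metric `g(x,y) + η(x) η(y)`, `η = g(n, ·)`, associated with a vector `n`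
transversal to `M` at `u`. -/
def assocMetric (u : M) (n : TangentSpace 𝓘(ℝ, F) (f u)) (x y : TangentSpace 𝓘(ℝ, E) u) : ℝ :=
  indMetric g f u x y +
    g.val (f u) n (mfderiv 𝓘(ℝ, E) 𝓘(ℝ, F) f u x) *
      g.val (f u) n (mfderiv 𝓘(ℝ, E) 𝓘(ℝ, F) f u y)

/-- `J` is the pseudo-Jacobi operator `J_R(x)` on `T_u M`, defined with the associated metric `g̃`
of a normalizing pair `(ξ, n)` by `g̃(J_R(x) y, w) = R(y, x, x, w)`. The vectors `x`, `y`, `w` are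
represented by the values at `u` of smooth vector fields `X`, `Y`, `W`. -/
def IsPseudoJacobi (u : M) (n : TangentSpace 𝓘(ℝ, F) (f u)) (x : TangentSpace 𝓘(ℝ, E) u)
    (J : TangentSpace 𝓘(ℝ, E) u →ₗ[ℝ] TangentSpace 𝓘(ℝ, E) u) : Prop :=
  ∀ X Y W : VField E M, SmoothField X → SmoothField Y → SmoothField W → X u = x →
    assocMetric g f u n (J (Y u)) (W u) = indCurv4 g D f S Y X X W u

/-- `M` is spacelike (`ε = 1`) or timelike (`ε = -1`) Osserman at `u`: for each admissible screen,
the characteristic polynomial of `J_R(x)` is the same for all `x ∈ T_u M` with `g(x,x) = ε`. -/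
def IsOssermanAt [FiniteDimensional ℝ E] (ε : ℝ) (u : M) : Prop :=
  ∀ S' : (Π u : M, Submodule ℝ (TangentSpace 𝓘(ℝ, E) u)), IsAdmissible g D f S' →
    ∀ (ξ : TangentSpace 𝓘(ℝ, E) u) (n : TangentSpace 𝓘(ℝ, F) (f u)),
      IsNormalizingPairAt g f S' u ξ n →
      ∃ P : Polynomial ℝ, ∀ x : TangentSpace 𝓘(ℝ, E) u, indMetric g f u x x = ε →
        ∀ J : TangentSpace 𝓘(ℝ, E) u →ₗ[ℝ] TangentSpace 𝓘(ℝ, E) u,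
          IsPseudoJacobi g D f S' u n x J → J.charpoly = P

/-- `M` is pointwise Osserman: at every point it is spacelike or timelike Osserman. -/
def IsPointwiseOsserman [FiniteDimensional ℝ E] : Prop :=
  ∀ u : M, IsOssermanAt (E := E) g D f 1 u ∨ IsOssermanAt (E := E) g D f (-1) u

/-- `A_N ξ` is a non-null vector field: around every point there is a smooth normalizing pair
`(ξ, N)` with `g(A_N ξ, A_N ξ) ≠ 0` everywhere. (The vector field `A_N ξ` does not depend on the
normalizing pair, only on the screen.) -/
def ShapeXiNonNull : Prop :=
  ∀ u₀ : M, ∃ U : Set M, IsOpen U ∧ u₀ ∈ U ∧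
    ∃ (ξ : VField E M) (n : Π u : M, TangentSpace 𝓘(ℝ, F) (f u)),
      SmoothFieldOn ξ U ∧
      ContMDiffOn 𝓘(ℝ, E) 𝓘(ℝ, F).tangent ∞
        (fun u => (⟨f u, n u⟩ : TangentBundle 𝓘(ℝ, F) N)) U ∧
      ∀ u ∈ U, IsNormalizingPairAt g f S u (ξ u) (n u) ∧
        indMetric g f u (shapeOp g D f S n u (ξ u)) (shapeOp g D f S n u (ξ u)) ≠ 0

/-- `(M, g, S)` is locally symmetric: `(∇_W R)(X,Y)Z = 0` for all `X, Y, Z, W ∈ Γ(TM)`. -/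
def IsLocallySymmetric : Prop :=
  ∀ W X Y Z : VField E M, SmoothField W → SmoothField X → SmoothField Y → SmoothField Z →
    indConn g D f S W (indCurv g D f S X Y Z)
      - indCurv g D f S (indConn g D f S W X) Y Z
      - indCurv g D f S X (indConn g D f S W Y) Z
      - indCurv g D f S X Y (indConn g D f S W Z) = 0

/-- `(M, g, S)` is semi-symmetric: `(R(V₁,V₂) · R)(X,Y,Z,T) = 0` for all vector fields in `Γ(TM)`,
where `R(V₁,V₂)` acts as a derivation on the `(0,4)` curvature tensor. -/
def IsSemiSymmetric : Prop :=
  ∀ V₁ V₂ X Y Z T : VField E M, SmoothField V₁ → SmoothField V₂ →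
    SmoothField X → SmoothField Y → SmoothField Z → SmoothField T →
    -indCurv4 g D f S (indCurv g D f S V₁ V₂ X) Y Z T
      - indCurv4 g D f S X (indCurv g D f S V₁ V₂ Y) Z T
      - indCurv4 g D f S X Y (indCurv g D f S V₁ V₂ Z) T
      - indCurv4 g D f S X Y Z (indCurv g D f S V₁ V₂ T) = 0

end Hypersurface

end LightlikeGeometry

end

/-!
Let `B(Y, Z) = ḡ(∇̄_Y Z, ξ)` be the local second fundamental form, so that
`∇̄_Y Z = ∇_Y Z + B(Y, Z) N`. It vanishes when one argument is `ξ`, and the tangential part of the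
ambient curvature gives the Gauss equation
`R(X, Y)Z = c (g(Y, Z) X - g(X, Z) Y) + B(Y, Z) A_N X - B(X, Z) A_N Y`.
Inserting `ξ` and `W = A_N ξ` in the pair symmetry `R(ξ, Y, Z, W) = R(Z, W, ξ, Y)` leaves
`B(Y, Z) g(A_N ξ, A_N ξ) = 0`, so `B = 0` if `A_N ξ` is non-null. The hypersurface is then totally
geodesic, hence `∇g = 0`, and `R(X, Y)Z = c (g(Y, Z) X - g(X, Z) Y)` is parallel; moreover
`R(V₁, V₂)` is skew for `g` and therefore annihilates `R`. Both properties thus hold.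

Derivatives along the immersion `f` are reduced to the connection of the ambient manifold by means
of smooth local left inverses of `f`: a smooth vector field along `f` is locally of the form `Y ∘ f`
with `Y` a smooth vector field on the ambient manifold.
-/

noncomputable section

namespace LightlikeGeometry

open scoped Topology
open Bundle Filter VectorField

variable {E : Type*} [NormedAddCommGroup E] [NormedSpace ℝ E]
  {M : Type*} [TopologicalSpace M] [ChartedSpace E M]
  {F : Type*} [NormedAddCommGroup F] [NormedSpace ℝ F]
  {N : Type*} [TopologicalSpace N] [ChartedSpace F N]
  {G : Type*} [NormedAddCommGroup G] [NormedSpace ℝ G]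

local notation "tangentTriv" => trivializationAt F (TangentSpace 𝓘(ℝ, F) : N → Type _)

section SmoothNear

variable {H : Type*} [TopologicalSpace H] {I : ModelWithCorners ℝ E H}
  {P : Type*} [TopologicalSpace P] [ChartedSpace H P]
  {H' : Type*} [TopologicalSpace H'] {I' : ModelWithCorners ℝ F H'}
  {Q : Type*} [TopologicalSpace Q] [ChartedSpace H' Q]

variable (I I') in
/-- `φ` is smooth on a neighbourhood of `u`. This is stronger than `ContMDiffAt I I' ∞ φ u`, which
gives a neighbourhood on which `φ` is of class `C^n` for each finite `n` separately. -/
def SmoothNear (φ : P → Q) (u : P) : Prop :=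
  ∀ᶠ x in 𝓝 u, ContMDiffAt I I' ∞ φ x

variable {φ ψ : P → Q} {u : P}

lemma SmoothNear.eventually (h : SmoothNear I I' φ u) : ∀ᶠ x in 𝓝 u, SmoothNear I I' φ x :=
  eventually_eventually_nhds.2 h

lemma SmoothNear.contMDiffAt (h : SmoothNear I I' φ u) : ContMDiffAt I I' ∞ φ u :=
  h.self_of_nhds

lemma SmoothNear.mdifferentiableAt (h : SmoothNear I I' φ u) : MDifferentiableAt I I' φ u :=
  h.contMDiffAt.mdifferentiableAt (by simp)

lemma SmoothNear.congr (h : SmoothNear I I' φ u) (hφψ : φ =ᶠ[𝓝 u] ψ) : SmoothNear I I' ψ u := by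
  filter_upwards [h, hφψ.eventuallyEq_nhds] with x hx hx'
  exact hx.congr_of_eventuallyEq hx'.symm

lemma SmoothNear.comp {G' : Type*} {H'' : Type*} [NormedAddCommGroup G'] [NormedSpace ℝ G']
    [TopologicalSpace H''] {I'' : ModelWithCorners ℝ G' H''} {R : Type*} [TopologicalSpace R]
    [ChartedSpace H'' R] {θ : Q → R} (hθ : SmoothNear I' I'' θ (φ u)) (hφ : SmoothNear I I' φ u) :
    SmoothNear I I'' (θ ∘ φ) u := by
  filter_upwards [hφ, hφ.contMDiffAt.continuousAt.eventually hθ] with x hφx hθx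
  exact hθx.comp x hφx

end SmoothNear

lemma smoothNear_extChartAt [IsManifold 𝓘(ℝ, E) ∞ M] (u : M) :
    SmoothNear 𝓘(ℝ, E) 𝓘(ℝ, E) (extChartAt 𝓘(ℝ, E) u) u := by
  filter_upwards [(chartAt E u).open_source.mem_nhds (mem_chart_source E u)] with x hx
  exact contMDiffAt_extChartAt' hx

lemma smoothNear_extChartAt_symm [IsManifold 𝓘(ℝ, E) ∞ M] (u : M) :
    SmoothNear 𝓘(ℝ, E) 𝓘(ℝ, E) (extChartAt 𝓘(ℝ, E) u).symm (extChartAt 𝓘(ℝ, E) u u) := by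
  filter_upwards [(isOpen_extChartAt_target u).eventually_mem (mem_extChartAt_target u)] with y hy
  exact (contMDiffOn_extChartAt_symm u).contMDiffAt ((isOpen_extChartAt_target u).mem_nhds hy)

/-- The vector field `X` is smooth on a neighbourhood of `u`. -/
abbrev SmoothFieldNear [IsManifold 𝓘(ℝ, E) ∞ M] (X : VField E M) (u : M) : Prop :=
  SmoothNear 𝓘(ℝ, E) 𝓘(ℝ, E).tangent (T% X) u

variable (E) in
/-- The vector field `V` along `f` is smooth on a neighbourhood of `u`. -/
abbrev SmoothAlongNear [IsManifold 𝓘(ℝ, F) ∞ N] (f : M → N)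
    (V : Π u : M, TangentSpace 𝓘(ℝ, F) (f u)) (u : M) : Prop :=
  SmoothNear 𝓘(ℝ, E) 𝓘(ℝ, F).tangent (fun x => (⟨f x, V x⟩ : TangentBundle 𝓘(ℝ, F) N)) u

lemma SmoothField.near [IsManifold 𝓘(ℝ, E) ∞ M] {X : VField E M} (hX : SmoothField X) (u : M) :
    SmoothFieldNear X u :=
  Eventually.of_forall hX

lemma SmoothAlongNear.smoothNear [IsManifold 𝓘(ℝ, F) ∞ N] {f : M → N}
    {V : Π u : M, TangentSpace 𝓘(ℝ, F) (f u)} {u : M} (hV : SmoothAlongNear E f V u) :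
    SmoothNear 𝓘(ℝ, E) 𝓘(ℝ, F) f u :=
  hV.mono fun _ hx => (contMDiffAt_totalSpace.1 hx).1

lemma SmoothAlongNear.congr [IsManifold 𝓘(ℝ, F) ∞ N] {f : M → N}
    {V W : Π u : M, TangentSpace 𝓘(ℝ, F) (f u)} {u : M} (hV : SmoothAlongNear E f V u)
    (hVW : ∀ᶠ x in 𝓝 u, V x = W x) : SmoothAlongNear E f W u :=
  SmoothNear.congr hV (hVW.mono fun x hx => congrArg (TotalSpace.mk' F (f x)) hx)

section Extension

variable [FiniteDimensional ℝ E] [T2Space M] [IsManifold 𝓘(ℝ, E) ∞ M]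

lemma SmoothFieldNear.exists_smoothField {X : VField E M} {u : M} (hX : SmoothFieldNear X u) :
    ∃ Y : VField E M, SmoothField Y ∧ ∀ᶠ x in 𝓝 u, Y x = X x := by
  obtain ⟨φ, -, hφX⟩ := ((SmoothBumpFunction.nhds_basis_tsupport (I := 𝓘(ℝ, E)) u).mem_iff).1 hX
  refine ⟨fun x => φ x • X x, fun x => ?_, ?_⟩
  · by_cases hx : x ∈ tsupport φ
    · exact ContMDiffAt.smul_section φ.contMDiffAt (hφX hx)
    · have hzero := contMDiff_zeroSection (n := ∞) (IB := 𝓘(ℝ, E)) (F := E) ℝ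
        (TangentSpace 𝓘(ℝ, E) : M → Type _) x
      refine hzero.congr_of_eventuallyEq ?_
      filter_upwards [(isClosed_tsupport φ).isOpen_compl.mem_nhds hx] with y hy
      rw [image_eq_zero_of_notMem_tsupport hy, zero_smul]
      rfl
  · filter_upwards [φ.eventuallyEq_one] with x hx
    rw [hx, Pi.one_apply, one_smul]

end Extension

section LocalLeftInverse

lemma exists_contDiffAt_localInverse [CompleteSpace E] {ψ : E → E} {a : E}
    (hψ : ∀ᶠ x in 𝓝 a, ContDiffAt ℝ ∞ ψ x) (hψa : HasFDerivAt ψ (ContinuousLinearMap.id ℝ E) a) :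
    ∃ ρ : E → E, (∀ᶠ y in 𝓝 (ψ a), ContDiffAt ℝ ∞ ρ y) ∧ ∀ᶠ x in 𝓝 a, ρ (ψ x) = x := by
  have hψa' : HasFDerivAt ψ (ContinuousLinearEquiv.refl ℝ E : E →L[ℝ] E) a := hψa
  set e := hψ.self_of_nhds.toOpenPartialHomeomorph ψ hψa' (by simp)
  have ha : a ∈ e.source := hψ.self_of_nhds.mem_toOpenPartialHomeomorph_source hψa' (by simp)
  have hfderiv : ContinuousAt (fderiv ℝ ψ) a :=
    (hψ.self_of_nhds.fderiv_right (m := 0) (by simp)).continuousAt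
  have hequiv : ∀ᶠ x in 𝓝 a, fderiv ℝ ψ x ∈ Set.range ((↑) : (E ≃L[ℝ] E) → E →L[ℝ] E) := by
    refine hfderiv.eventually_mem ?_
    rw [hψa.fderiv]
    exact (ContinuousLinearEquiv.refl ℝ E).nhds
  refine ⟨e.symm, ?_, e.eventually_left_inverse ha⟩
  have hsymm : Tendsto e.symm (𝓝 (ψ a)) (𝓝 a) := e.tendsto_symm ha
  filter_upwards [e.open_target.mem_nhds (e.map_source ha), hsymm.eventually hψ,
    hsymm.eventually hequiv] with y hy hψy ⟨L, hL⟩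
  refine e.contDiffAt_symm (f₀' := L) hy ?_ hψy
  rw [hL]
  exact (hψy.differentiableAt (by simp)).hasFDerivAt

lemma exists_contDiffAt_leftInverse [FiniteDimensional ℝ F] [CompleteSpace E] {φ : E → F} {a : E}
    (hφ : ∀ᶠ x in 𝓝 a, ContDiffAt ℝ ∞ φ x) (hinj : Function.Injective (fderiv ℝ φ a)) :
    ∃ ρ : F → E, (∀ᶠ y in 𝓝 (φ a), ContDiffAt ℝ ∞ ρ y) ∧ ∀ᶠ x in 𝓝 a, ρ (φ x) = x := by
  obtain ⟨L, hL⟩ :=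
    ContinuousLinearMap.HasLeftInverse.of_injective_of_finiteDimensional hinj
  have hLφ : HasFDerivAt (L ∘ φ) (ContinuousLinearMap.id ℝ E) a := by
    convert! L.hasFDerivAt.comp a (hφ.self_of_nhds.differentiableAt (by simp)).hasFDerivAt
    ext v
    exact (hL v).symm
  obtain ⟨ρ, hρ, hρφ⟩ := exists_contDiffAt_localInverse
    (hφ.mono fun x hx => L.contDiff.contDiffAt.comp x hx) hLφ
  exact ⟨ρ ∘ L, (L.continuous.continuousAt.eventually hρ).mono
    fun y hy => hy.comp y L.contDiff.contDiffAt, hρφ⟩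

variable [IsManifold 𝓘(ℝ, E) ∞ M] [IsManifold 𝓘(ℝ, F) ∞ N]

theorem SmoothNear.exists_leftInverse [FiniteDimensional ℝ E] [FiniteDimensional ℝ F]
    {f : M → N} {u : M} (hf : SmoothNear 𝓘(ℝ, E) 𝓘(ℝ, F) f u)
    (hinj : Function.Injective (mfderiv% f u)) :
    ∃ r : N → M, SmoothNear 𝓘(ℝ, F) 𝓘(ℝ, E) r (f u) ∧ ∀ᶠ x in 𝓝 u, r (f x) = x := by
  set φ := extChartAt 𝓘(ℝ, E) u
  set χ := extChartAt 𝓘(ℝ, F) (f u)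
  have hφ : SmoothNear 𝓘(ℝ, E) 𝓘(ℝ, E) φ u := smoothNear_extChartAt u
  have hχ : SmoothNear 𝓘(ℝ, F) 𝓘(ℝ, F) χ (f u) := smoothNear_extChartAt (f u)
  have hφsymm : SmoothNear 𝓘(ℝ, E) 𝓘(ℝ, E) φ.symm (φ u) := smoothNear_extChartAt_symm u
  have hφu : φ.symm (φ u) = u := extChartAt_to_inv u
  have hψ : SmoothNear 𝓘(ℝ, E) 𝓘(ℝ, F) (χ ∘ f ∘ φ.symm) (φ u) :=
    SmoothNear.comp (by rwa [Function.comp_apply, hφu]) (SmoothNear.comp (by rwa [hφu]) hφsymm)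
  have hder : fderiv ℝ (χ ∘ f ∘ φ.symm) (φ u) = mfderiv% f u := by
    rw [hf.mdifferentiableAt.mfderiv]
    simp [writtenInExtChartAt, φ, χ]
  obtain ⟨ρ, hρ, hρψ⟩ :=
    exists_contDiffAt_leftInverse (hψ.mono fun y hy => hy.contDiffAt) (by rwa [hder])
  have hρ' : SmoothNear 𝓘(ℝ, F) 𝓘(ℝ, E) ρ (χ (f u)) := by
    rw [← hφu]
    exact hρ.mono fun y hy => hy.contMDiffAt
  have hρu : ρ (χ (f u)) = φ u := by simpa [hφu] using hρψ.self_of_nhds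
  refine ⟨φ.symm ∘ ρ ∘ χ, SmoothNear.comp (by rwa [Function.comp_apply, hρu]) (hρ'.comp hχ), ?_⟩
  filter_upwards [hφ.contMDiffAt.continuousAt.eventually hρψ,
    extChartAt_source_mem_nhds (I := 𝓘(ℝ, E)) u] with x hx hxφ
  simp only [Function.comp_apply, φ.left_inv hxφ] at hx ⊢
  rw [hx, φ.left_inv hxφ]

end LocalLeftInverse

section FieldsAlong

variable [IsManifold 𝓘(ℝ, F) ∞ N]

/-- The components of a vector field along `f`, in the trivialization around `f u`. -/
def alongComp (f : M → N) (V : Π u : M, TangentSpace 𝓘(ℝ, F) (f u)) (u x : M) : F :=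
  (tangentTriv (f u) ⟨f x, V x⟩).2

variable (F) in
lemma eventually_mem_tangentTriv_baseSet (p : N) : ∀ᶠ q in 𝓝 p, q ∈ (tangentTriv p).baseSet :=
  (tangentTriv p).open_baseSet.mem_nhds (FiberBundle.mem_baseSet_trivializationAt' p)

lemma mdifferentiableAt_alongComp_id {Y : VField F N} {p : N} (hY : MDiffAt (T% Y) p) :
    MDiffAt (alongComp id Y p) p :=
  ((mdifferentiableAt_totalSpace 𝓘(ℝ, F) _).1 hY).2

variable {f : M → N} {u : M} {V : Π u : M, TangentSpace 𝓘(ℝ, F) (f u)}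

lemma SmoothAlongNear.smoothNear_alongComp (hV : SmoothAlongNear E f V u) :
    SmoothNear 𝓘(ℝ, E) 𝓘(ℝ, F) (alongComp f V u) u := by
  filter_upwards [hV, hV.smoothNear.contMDiffAt.continuousAt.eventually
    (eventually_mem_tangentTriv_baseSet F (f u))] with x hx hxt
  exact (((tangentTriv (f u)).contMDiffAt_iff ((tangentTriv (f u)).mem_source.2 hxt)).1 hx).2

lemma SmoothNear.smoothFieldNear_symm {w : N → F} {p : N} (hw : SmoothNear 𝓘(ℝ, F) 𝓘(ℝ, F) w p) :
    SmoothFieldNear (fun q => (tangentTriv p).symm q (w q)) p := by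
  filter_upwards [hw, eventually_mem_tangentTriv_baseSet F p] with q hq hqt
  rw [(tangentTriv p).contMDiffAt_section_iff (IB := 𝓘(ℝ, F)) (n := ∞) hqt]
  refine hq.congr_of_eventuallyEq ?_
  filter_upwards [(tangentTriv p).open_baseSet.mem_nhds hqt] with y hy
  rw [Trivialization.apply_mk_symm _ hy]

lemma symm_alongComp_eventuallyEq (hf : ContinuousAt f u) :
    ∀ᶠ x in 𝓝 u, (tangentTriv (f u)).symm (f x) (alongComp f V u x) = V x := by
  filter_upwards [hf.eventually (eventually_mem_tangentTriv_baseSet F (f u))] with x hx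
  exact Trivialization.symm_apply_apply_mk _ hx _

lemma SmoothAlongNear.smul (hV : SmoothAlongNear E f V u) {a : M → ℝ}
    (ha : SmoothNear 𝓘(ℝ, E) 𝓘(ℝ, ℝ) a u) : SmoothAlongNear E f (a • V) u := by
  filter_upwards [ha, hV] with x hax hVx
  have hV' := contMDiffAt_totalSpace.1 hVx
  refine contMDiffAt_totalSpace.2 ⟨hV'.1, (hax.smul hV'.2).congr_of_eventuallyEq ?_⟩
  filter_upwards [hV'.1.continuousAt.eventually (eventually_mem_tangentTriv_baseSet F (f x))]
    with y hy
  exact ((tangentTriv (f x)).linear ℝ hy).map_smul (a y) (V y)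

lemma exists_smoothFieldNear_eq {p : N} (v : TangentSpace 𝓘(ℝ, F) p) :
    ∃ Y : VField F N, SmoothFieldNear Y p ∧ Y p = v :=
  ⟨_, SmoothNear.smoothFieldNear_symm (w := fun _ => (tangentTriv p ⟨p, v⟩).2)
    (Eventually.of_forall fun _ => contMDiffAt_const),
    Trivialization.symm_apply_apply_mk _ (FiberBundle.mem_baseSet_trivializationAt' p) v⟩

variable [FiniteDimensional ℝ F] [T2Space N]

lemma exists_smoothField_eq {p : N} (v : TangentSpace 𝓘(ℝ, F) p) :
    ∃ Y : VField F N, SmoothField Y ∧ Y p = v := by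
  obtain ⟨X, hX, rfl⟩ := exists_smoothFieldNear_eq v
  obtain ⟨Y, hY, hYX⟩ := hX.exists_smoothField
  exact ⟨Y, hY, hYX.self_of_nhds⟩

/-- Through a local left inverse of the immersion `f`, the components of a field along `f` become
functions on `N`. -/
theorem SmoothAlongNear.exists_smoothField [FiniteDimensional ℝ E] [IsManifold 𝓘(ℝ, E) ∞ M]
    (hV : SmoothAlongNear E f V u) (hinj : Function.Injective (mfderiv% f u)) :
    ∃ Y : VField F N, SmoothField Y ∧ ∀ᶠ x in 𝓝 u, Y (f x) = V x := by
  obtain ⟨r, hr, hrf⟩ := hV.smoothNear.exists_leftInverse hinj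
  have hw : SmoothNear 𝓘(ℝ, F) 𝓘(ℝ, F) (alongComp f V u ∘ r) (f u) :=
    SmoothNear.comp (by rw [hrf.self_of_nhds]; exact hV.smoothNear_alongComp) hr
  obtain ⟨Y, hY, hYe⟩ := hw.smoothFieldNear_symm.exists_smoothField
  have hfc := hV.smoothNear.contMDiffAt.continuousAt
  refine ⟨Y, hY, ?_⟩
  filter_upwards [hfc.eventually hYe, hrf, symm_alongComp_eventuallyEq (F := F) hfc]
    with x hx hrx hVx
  rw [hx, Function.comp_apply, hrx, hVx]

end FieldsAlong

lemma mvfderiv_congr_of_eventuallyEq {a b : M → G} {u : M} (hab : a =ᶠ[𝓝 u] b) :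
    d% a u = d% b u :=
  ContinuousLinearMap.ext fun x =>
    congrArg (fun L : E →L[ℝ] G => L x) (hab.mfderiv_eq (I := 𝓘(ℝ, E)) (I' := 𝓘(ℝ, G)))

lemma mvfderiv_comp_map_apply {f : M → N} {h : N → G} {u : M} (hh : MDiffAt h (f u))
    (hf : MDiffAt f u) (x : TangentSpace 𝓘(ℝ, E) u) :
    d% (fun y => h (f y)) u x = d% h (f u) (mfderiv% f u x) :=
  mfderiv_comp_apply u hh hf x

section CovAlong

variable [IsManifold 𝓘(ℝ, F) ∞ N] {f : M → N} {u : M} {D : Connection F N}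
  {V W : Π u : M, TangentSpace 𝓘(ℝ, F) (f u)}

lemma covAlong_eq (x : TangentSpace 𝓘(ℝ, E) u) :
    covAlong D f V u x = (tangentTriv (f u)).symmL ℝ (f u) (d% (alongComp f V u) u x) +
      D (FiberBundle.extend F (V u)) (f u) (mfderiv% f u x) := by
  rw [Trivialization.symmL_apply _ (FiberBundle.mem_baseSet_trivializationAt' (f u))]
  rfl

lemma covAlong_congr (hVW : ∀ᶠ x in 𝓝 u, V x = W x) (x : TangentSpace 𝓘(ℝ, E) u) :
    covAlong D f V u x = covAlong D f W u x := by
  have hcomp : alongComp f V u =ᶠ[𝓝 u] alongComp f W u :=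
    hVW.mono fun y hy => by simp only [alongComp, hy]
  rw [covAlong_eq, covAlong_eq, mvfderiv_congr_of_eventuallyEq hcomp, hVW.self_of_nhds]

lemma tensorialAt_connection_sub (p : N) (w : TangentSpace 𝓘(ℝ, F) p) :
    TensorialAt 𝓘(ℝ, F) F (fun Y : VField F N =>
      D Y p w - (tangentTriv p).symmL ℝ p (d% (alongComp id Y p) p w)) p where
  smul {a Y} ha hY := by
    have hcomp : alongComp id (a • Y) p =ᶠ[𝓝 p] a • alongComp id Y p :=
      (eventually_mem_tangentTriv_baseSet F p).mono fun q hq =>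
        ((tangentTriv p).linear ℝ hq).map_smul _ _
    have hYp : (tangentTriv p).symmL ℝ p (alongComp id Y p p) = Y p := by
      have hp := FiberBundle.mem_baseSet_trivializationAt F (TangentSpace 𝓘(ℝ, F) : N → Type _) p
      rw [Trivialization.symmL_apply _ hp]
      exact Trivialization.symm_apply_apply_mk _ hp _
    rw [mvfderiv_congr_of_eventuallyEq hcomp, mvfderiv_smul ha (mdifferentiableAt_alongComp_id hY),
      D.isCovariantDerivativeOn.leibniz (s := Set.univ) hY ha trivial]
    simp only [add_apply, smul_apply, ContinuousLinearMap.smulRight_apply, map_add, map_smul,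
      hYp, smul_sub]
    abel
  add {Y Z} hY hZ := by
    have hcomp : alongComp id (Y + Z) p =ᶠ[𝓝 p] alongComp id Y p + alongComp id Z p :=
      (eventually_mem_tangentTriv_baseSet F p).mono fun q hq =>
        ((tangentTriv p).linear ℝ hq).map_add _ _
    rw [mvfderiv_congr_of_eventuallyEq hcomp, mvfderiv_add (mdifferentiableAt_alongComp_id hY)
      (mdifferentiableAt_alongComp_id hZ),
      D.isCovariantDerivativeOn.add (s := Set.univ) hY hZ trivial]
    simp only [add_apply, map_add]
    abel

lemma mvfderiv_alongComp_extend {p : N} (v : TangentSpace 𝓘(ℝ, F) p) :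
    d% (alongComp id (FiberBundle.extend F v : VField F N) p) p = 0 := by
  have hconst : alongComp id (FiberBundle.extend F v : VField F N) p =ᶠ[𝓝 p]
      fun _ => (tangentTriv p ⟨p, v⟩).2 :=
    (eventually_mem_tangentTriv_baseSet F p).mono fun q hq => by
      change (tangentTriv p ⟨q, (tangentTriv p).symm q (tangentTriv p ⟨p, v⟩).2⟩).2 = _
      rw [Trivialization.apply_mk_symm _ hq]
  rw [mvfderiv_congr_of_eventuallyEq hconst, mvfderiv_const]

variable [FiniteDimensional ℝ F]

lemma connection_eq_alongComp {Y : VField F N} {p : N} (hY : MDiffAt (T% Y) p)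
    (w : TangentSpace 𝓘(ℝ, F) p) :
    D Y p w = (tangentTriv p).symmL ℝ p (d% (alongComp id Y p) p w) +
      D (FiberBundle.extend F (Y p)) p w := by
  have h := (tensorialAt_connection_sub (D := D) p w).pointwise hY
    (FiberBundle.mdifferentiableAt_extend 𝓘(ℝ, F) F (Y p)) (FiberBundle.extend_apply_self F _).symm
  simp only [mvfderiv_alongComp_extend, zero_apply, map_zero, sub_zero] at h
  exact sub_eq_iff_eq_add'.1 h

theorem covAlong_comp {Y : VField F N} (hY : MDiffAt (T% Y) (f u)) (hf : MDiffAt f u)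
    (x : TangentSpace 𝓘(ℝ, E) u) :
    covAlong D f (fun x => Y (f x)) u x = D Y (f u) (mfderiv% f u x) := by
  rw [covAlong_eq, connection_eq_alongComp hY,
    ← mvfderiv_comp_map_apply (mdifferentiableAt_alongComp_id hY) hf]
  rfl

end CovAlong

section Smoothness

lemma SmoothNear.mvfderiv_apply [IsManifold 𝓘(ℝ, E) ∞ M] {a : M → G} {u : M} {X : VField E M}
    (ha : SmoothNear 𝓘(ℝ, E) 𝓘(ℝ, G) a u) (hX : SmoothFieldNear X u) :
    SmoothNear 𝓘(ℝ, E) 𝓘(ℝ, G) (fun x => d% a x (X x)) u := by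
  filter_upwards [ha, hX] with x hax hXx
  have happ := ContMDiffAt.clm_apply_of_inCoordinates (hax.mfderiv_const (m := ∞) (by simp)) hXx hax
  exact (contMDiff_snd_tangentBundle_modelSpace G 𝓘(ℝ, G)).contMDiffAt.comp x happ

variable [IsManifold 𝓘(ℝ, F) ∞ N] {f : M → N} {u : M}

variable (F) in
/-- The vector field `df(X)` along `f`. -/
abbrev pushAlong (f : M → N) (X : VField E M) : Π u : M, TangentSpace 𝓘(ℝ, F) (f u) :=
  fun x => mfderiv% f x (X x)

lemma smoothAlongNear_pushAlong [IsManifold 𝓘(ℝ, E) ∞ M] {X : VField E M}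
    (hX : SmoothFieldNear X u) (hf : SmoothNear 𝓘(ℝ, E) 𝓘(ℝ, F) f u) :
    SmoothAlongNear E f (pushAlong F f X) u := by
  filter_upwards [hX, hf] with x hXx hfx
  exact ContMDiffAt.clm_apply_of_inCoordinates (hfx.mfderiv_const (m := ∞) (by simp)) hXx hfx

variable {V W : Π u : M, TangentSpace 𝓘(ℝ, F) (f u)}

lemma SmoothAlongNear.metric (g : SemiRiemannianMetric F N) (hV : SmoothAlongNear E f V u)
    (hW : SmoothAlongNear E f W u) :
    SmoothNear 𝓘(ℝ, E) 𝓘(ℝ, ℝ) (fun x => g.val (f x) (V x) (W x)) u := by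
  filter_upwards [hV, hW, hV.smoothNear] with x hVx hWx hfx
  have h := ContMDiffAt.clm_bundle_apply₂ (F₁ := F) (F₂ := F) (F₃ := ℝ) (E₃ := fun _ : N => ℝ)
    (g.contMDiff.contMDiffAt.comp x hfx) hVx hWx
  exact (contMDiffAt_totalSpace.1 h).2

end Smoothness

section CovAlong

variable [FiniteDimensional ℝ F] [IsManifold 𝓘(ℝ, F) ∞ N]
  {f : M → N} {u : M} {D : Connection F N} {V W : Π u : M, TangentSpace 𝓘(ℝ, F) (f u)}

lemma covAlong_eq_of_eventuallyEq {Y : VField F N} (hY : SmoothField Y) (hf : MDiffAt f u)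
    (hYV : ∀ᶠ x in 𝓝 u, Y (f x) = V x) (w : TangentSpace 𝓘(ℝ, E) u) :
    covAlong D f V u w = D Y (f u) (mfderiv% f u w) := by
  rw [← covAlong_comp ((hY.near (f u)).mdifferentiableAt) hf]
  exact covAlong_congr (hYV.mono fun _ => Eq.symm) w

variable [FiniteDimensional ℝ E] [IsManifold 𝓘(ℝ, E) ∞ M] [T2Space N]

theorem SmoothAlongNear.covAlong_apply
    (hD : CovariantDerivative.ContMDiffCovariantDerivative D ∞) {X : VField E M}
    (hX : SmoothFieldNear X u) (hV : SmoothAlongNear E f V u)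
    (hinj : Function.Injective (mfderiv% f u)) :
    SmoothAlongNear E f (fun x => covAlong D f V x (X x)) u := by
  obtain ⟨Y, hY, hYV⟩ := hV.exists_smoothField hinj
  have hDY := hD.contMDiff.contMDiff (σ := Y) (by simpa using! hY.contMDiffOn)
  have hDYX : SmoothAlongNear E f (fun x => D Y (f x) (mfderiv% f x (X x))) u := by
    filter_upwards [smoothAlongNear_pushAlong hX hV.smoothNear, hV.smoothNear] with x hx hfx
    exact ContMDiffAt.clm_bundle_apply ((hDY.contMDiffAt univ_mem).comp x hfx) hx
  refine hDYX.congr ?_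
  filter_upwards [hYV.eventually_nhds, hV.smoothNear.eventually] with x hx hfx
  rw [covAlong_eq_of_eventuallyEq hY hfx.mdifferentiableAt hx]

lemma covAlong_add (hV : SmoothAlongNear E f V u) (hW : SmoothAlongNear E f W u)
    (hinj : Function.Injective (mfderiv% f u)) (w : TangentSpace 𝓘(ℝ, E) u) :
    covAlong D f (V + W) u w = covAlong D f V u w + covAlong D f W u w := by
  obtain ⟨Y, hY, hYV⟩ := hV.exists_smoothField hinj
  obtain ⟨Z, hZ, hZW⟩ := hW.exists_smoothField hinj
  have hf := hV.smoothNear.mdifferentiableAt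
  have hYp := (hY.near (f u)).mdifferentiableAt
  have hZp := (hZ.near (f u)).mdifferentiableAt
  rw [covAlong_eq_of_eventuallyEq hY hf hYV, covAlong_eq_of_eventuallyEq hZ hf hZW, ← add_apply,
    ← D.isCovariantDerivativeOn.add (s := Set.univ) hYp hZp trivial,
    ← covAlong_comp (mdifferentiableAt_add_section hYp hZp) hf]
  refine covAlong_congr ?_ w
  filter_upwards [hYV, hZW] with x hx hx'
  rw [Pi.add_apply, Pi.add_apply, hx, hx']

lemma covAlong_smul {a : M → ℝ} (ha : MDiffAt a u) (hV : SmoothAlongNear E f V u)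
    (hinj : Function.Injective (mfderiv% f u)) (w : TangentSpace 𝓘(ℝ, E) u) :
    covAlong D f (a • V) u w = d% a u w • V u + a u • covAlong D f V u w := by
  obtain ⟨Y, hY, hYV⟩ := hV.exists_smoothField hinj
  obtain ⟨r, hr, hrf⟩ := hV.smoothNear.exists_leftInverse hinj
  have hf := hV.smoothNear.mdifferentiableAt
  have hYp := (hY.near (f u)).mdifferentiableAt
  have har : MDiffAt (a ∘ r) (f u) :=
    MDifferentiableAt.comp (f u) (by rwa [hrf.self_of_nhds]) hr.mdifferentiableAt
  have harf : (fun x => (a ∘ r) (f x)) =ᶠ[𝓝 u] a := hrf.mono fun x hx => congrArg a hx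
  have hYaV : ∀ᶠ x in 𝓝 u, (a • V) x = ((a ∘ r) • Y) (f x) := by
    filter_upwards [hYV, harf] with x hx hax
    rw [Pi.smul_apply', Pi.smul_apply', hx, ← hax, Function.comp_apply]
  rw [covAlong_congr hYaV, covAlong_comp (har.smul_section hYp) hf,
    D.isCovariantDerivativeOn.leibniz (s := Set.univ) hYp har trivial,
    covAlong_eq_of_eventuallyEq hY hf hYV, ← hYV.self_of_nhds,
    ← mvfderiv_congr_of_eventuallyEq harf, mvfderiv_comp_map_apply har hf, ← harf.self_of_nhds]
  simp only [add_apply, smul_apply, ContinuousLinearMap.smulRight_apply, Function.comp_apply]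
  exact add_comm _ _

lemma mvfderiv_metric {g : SemiRiemannianMetric F N} (hD : IsLeviCivita g D)
    (hV : SmoothAlongNear E f V u) (hW : SmoothAlongNear E f W u)
    (hinj : Function.Injective (mfderiv% f u)) (w : TangentSpace 𝓘(ℝ, E) u) :
    d% (fun x => g.val (f x) (V x) (W x)) u w =
      g.val (f u) (covAlong D f V u w) (W u) + g.val (f u) (V u) (covAlong D f W u w) := by
  obtain ⟨Y, hY, hYV⟩ := hV.exists_smoothField hinj
  obtain ⟨Z, hZ, hZW⟩ := hW.exists_smoothField hinj
  have hf := hV.smoothNear.mdifferentiableAt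
  have hYp := (hY.near (f u)).mdifferentiableAt
  have hZp := (hZ.near (f u)).mdifferentiableAt
  have hgYZ : MDiffAt (fun q => g.val q (Y q) (Z q)) (f u) :=
    (SmoothAlongNear.metric (f := id) g (hY.near (f u)) (hZ.near (f u))).mdifferentiableAt
  have heq : (fun x => g.val (f x) (V x) (W x)) =ᶠ[𝓝 u]
      fun x => g.val (f x) (Y (f x)) (Z (f x)) := by
    filter_upwards [hYV, hZW] with x hx hx'
    rw [hx, hx']
  rw [mvfderiv_congr_of_eventuallyEq heq,
    mvfderiv_comp_map_apply (h := fun q => g.val q (Y q) (Z q)) hgYZ hf, hD.metric Y Z _ hYp hZp,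
    covAlong_eq_of_eventuallyEq hY hf hYV, covAlong_eq_of_eventuallyEq hZ hf hZW,
    hYV.self_of_nhds, hZW.self_of_nhds]

end CovAlong

section LieBracket

variable [IsManifold 𝓘(ℝ, E) ∞ M] {X Y Z : VField E M} {a : M → ℝ} {u : M}

lemma SmoothFieldNear.smul (hZ : SmoothFieldNear Z u) (ha : SmoothNear 𝓘(ℝ, E) 𝓘(ℝ, ℝ) a u) :
    SmoothFieldNear (a • Z) u :=
  SmoothAlongNear.smul (f := id) hZ ha

variable [CompleteSpace E]

lemma SmoothFieldNear.mlieBracket (hX : SmoothFieldNear X u) (hY : SmoothFieldNear Y u) :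
    SmoothFieldNear (mlieBracket 𝓘(ℝ, E) X Y) u := by
  have : IsManifold 𝓘(ℝ, E) (minSmoothness ℝ 2) M := by
    rw [minSmoothness_of_isRCLikeNormedField]
    exact IsManifold.of_le (n := ∞) (by norm_cast)
  have : IsManifold 𝓘(ℝ, E) (((⊤ : ℕ∞) : ℕ∞ω) + 1) M := ‹IsManifold 𝓘(ℝ, E) ∞ M›
  filter_upwards [hX, hY] with x hXx hYx
  exact ContMDiffAt.mlieBracket_vectorField (n := ⊤) (m := ⊤) hXx hYx (by simp)

lemma mlieBracket_smul_eventuallyEq (X : VField E M) (ha : SmoothNear 𝓘(ℝ, E) 𝓘(ℝ, ℝ) a u)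
    (hZ : SmoothFieldNear Z u) : mlieBracket 𝓘(ℝ, E) X (a • Z) =ᶠ[𝓝 u]
      ((fun x => d% a x (X x)) • Z + a • mlieBracket 𝓘(ℝ, E) X Z : VField E M) := by
  have : IsManifold 𝓘(ℝ, E) 2 M := IsManifold.of_le (n := ∞) (by norm_cast)
  filter_upwards [ha.eventually, hZ.eventually] with x hax hZx
  exact mlieBracket_smul_right hax.mdifferentiableAt hZx.mdifferentiableAt

lemma mlieBracket_mlieBracket_smul (X : VField E M) (ha : SmoothNear 𝓘(ℝ, E) 𝓘(ℝ, ℝ) a u)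
    (hY : SmoothFieldNear Y u) (hZ : SmoothFieldNear Z u) :
    mlieBracket 𝓘(ℝ, E) X (mlieBracket 𝓘(ℝ, E) Y (a • Z)) u =
      (d% (fun x => d% a x (Y x)) u (X u) • Z u + d% a u (Y u) • mlieBracket 𝓘(ℝ, E) X Z u) +
      (d% a u (X u) • mlieBracket 𝓘(ℝ, E) Y Z u +
        a u • mlieBracket 𝓘(ℝ, E) X (mlieBracket 𝓘(ℝ, E) Y Z) u) := by
  have : IsManifold 𝓘(ℝ, E) 2 M := IsManifold.of_le (n := ∞) (by norm_cast)
  have hYa := ha.mvfderiv_apply hY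
  have hYZ := hY.mlieBracket hZ
  rw [EventuallyEq.rfl.mlieBracket_vectorField_eq (mlieBracket_smul_eventuallyEq Y ha hZ),
    mlieBracket_add_right (hZ.smul hYa).mdifferentiableAt (hYZ.smul ha).mdifferentiableAt,
    (mlieBracket_smul_eventuallyEq X hYa hZ).self_of_nhds,
    (mlieBracket_smul_eventuallyEq X ha hYZ).self_of_nhds]
  rfl

/-- The coefficient of `Z` in the Jacobi identity for `X`, `Y` and `a • Z`. -/
theorem mvfderiv_mlieBracket (ha : SmoothNear 𝓘(ℝ, E) 𝓘(ℝ, ℝ) a u) (hX : SmoothFieldNear X u)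
    (hY : SmoothFieldNear Y u) :
    d% a u (mlieBracket 𝓘(ℝ, E) X Y u) =
      d% (fun x => d% a x (Y x)) u (X u) - d% (fun x => d% a x (X x)) u (Y u) := by
  have : IsManifold 𝓘(ℝ, E) (minSmoothness ℝ 3) M := by
    rw [minSmoothness_of_isRCLikeNormedField]
    exact IsManifold.of_le (n := ∞) (by norm_cast)
  obtain htriv | hntriv := subsingleton_or_nontrivial (TangentSpace 𝓘(ℝ, E) u)
  · simp [Subsingleton.elim (X u) 0, Subsingleton.elim (Y u) 0,
      Subsingleton.elim (mlieBracket 𝓘(ℝ, E) X Y u) 0]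
  obtain ⟨z, hz⟩ := exists_ne (0 : TangentSpace 𝓘(ℝ, E) u)
  obtain ⟨Z, hZ, rfl⟩ := exists_smoothFieldNear_eq z
  have smooth {W : VField E M} (hW : SmoothFieldNear W u) :
      CMDiffAt (minSmoothness ℝ 2) (T% W) u := by
    rw [minSmoothness_of_isRCLikeNormedField]
    exact hW.contMDiffAt.of_le (by norm_cast)
  have jacobi := leibniz_identity_mlieBracket_apply (smooth hX) (smooth hY) (smooth (hZ.smul ha))
  have jacobiZ := leibniz_identity_mlieBracket_apply (smooth hX) (smooth hY) (smooth hZ)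
  rw [mlieBracket_mlieBracket_smul X ha hY hZ, mlieBracket_mlieBracket_smul Y ha hX hZ,
    (mlieBracket_smul_eventuallyEq (mlieBracket 𝓘(ℝ, E) X Y) ha hZ).self_of_nhds] at jacobi
  rw [← sub_eq_zero]
  refine (smul_eq_zero.1 ?_).resolve_right hz
  simp only [Pi.add_apply, Pi.smul_apply'] at jacobi
  rw [jacobiZ] at jacobi
  linear_combination (norm := module) -jacobi

end LieBracket

section Related

variable [IsManifold 𝓘(ℝ, E) ∞ M] [IsManifold 𝓘(ℝ, F) ∞ N]
  {f : M → N} {u : M} {X Y : VField E M} {X' Y' : VField F N}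

lemma eq_of_forall_mvfderiv_eq {p : N} {v w : TangentSpace 𝓘(ℝ, F) p}
    (h : ∀ a : N → ℝ, SmoothNear 𝓘(ℝ, F) 𝓘(ℝ, ℝ) a p → d% a p v = d% a p w) : v = w := by
  set χ := extChartAt 𝓘(ℝ, F) p
  have hχ : SmoothNear 𝓘(ℝ, F) 𝓘(ℝ, F) χ p := smoothNear_extChartAt p
  have hψχ (ψ : StrongDual ℝ F) (z : TangentSpace 𝓘(ℝ, F) p) :
      d% (fun q => ψ (χ q)) p z = ψ z := by
    rw [mvfderiv_comp_map_apply ψ.mdifferentiableAt hχ.mdifferentiableAt, mfderiv_extChartAt_self]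
    exact congrArg (fun L : F →L[ℝ] ℝ => L z) (ψ.mfderiv_eq (x := χ p))
  refine (SeparatingDual.eq_iff_forall_dual_eq (R := ℝ) (V := F)).2 fun ψ => ?_
  rw [← hψχ, ← hψχ]
  exact h _ (SmoothNear.comp (Eventually.of_forall fun _ => ψ.contMDiff.contMDiffAt) hχ)

theorem mfderiv_mlieBracket_of_related [CompleteSpace E] [CompleteSpace F]
    (hf : SmoothNear 𝓘(ℝ, E) 𝓘(ℝ, F) f u)
    (hX : SmoothFieldNear X u) (hY : SmoothFieldNear Y u)
    (hX' : SmoothFieldNear X' (f u)) (hY' : SmoothFieldNear Y' (f u))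
    (hXX' : ∀ᶠ x in 𝓝 u, X' (f x) = mfderiv% f x (X x))
    (hYY' : ∀ᶠ x in 𝓝 u, Y' (f x) = mfderiv% f x (Y x)) :
    mfderiv% f u (mlieBracket 𝓘(ℝ, E) X Y u) = mlieBracket 𝓘(ℝ, F) X' Y' (f u) := by
  refine eq_of_forall_mvfderiv_eq fun a ha => ?_
  have haf := ha.comp hf
  have comp_apply {Z : VField E M} {Z' : VField F N} (hZ' : SmoothFieldNear Z' (f u))
      (hZZ' : ∀ᶠ x in 𝓝 u, Z' (f x) = mfderiv% f x (Z x)) :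
      (fun x => d% (a ∘ f) x (Z x)) =ᶠ[𝓝 u] fun x => d% a (f x) (Z' (f x)) := by
    filter_upwards [hZZ', hf.eventually, hf.contMDiffAt.continuousAt.eventually ha.eventually]
      with x hx hfx hax
    rw [hx]
    exact mvfderiv_comp_map_apply hax.mdifferentiableAt hfx.mdifferentiableAt _
  have hafX := comp_apply hX' hXX'
  have hafY := comp_apply hY' hYY'
  rw [← mvfderiv_comp_map_apply ha.mdifferentiableAt hf.mdifferentiableAt,
    mvfderiv_mlieBracket ha hX' hY', hXX'.self_of_nhds, hYY'.self_of_nhds,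
    ← mvfderiv_comp_map_apply (ha.mvfderiv_apply hY').mdifferentiableAt hf.mdifferentiableAt,
    ← mvfderiv_comp_map_apply (ha.mvfderiv_apply hX').mdifferentiableAt hf.mdifferentiableAt,
    ← mvfderiv_congr_of_eventuallyEq hafX, ← mvfderiv_congr_of_eventuallyEq hafY]
  exact mvfderiv_mlieBracket haf hX hY

end Related

section AlgebraicCurvature

variable {W : Type*} [AddCommGroup W] [Module ℝ W]

/-- If `B'` is nonzero at `v`, then on the line `x + ℝ v` it vanishes at finitely many points. -/
lemma bilin_self_eq_zero {B B' : LinearMap.BilinForm ℝ W} (h : ∀ x, B' x x ≠ 0 → B x x = 0)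
    {v : W} (hv : B' v v ≠ 0) (x : W) : B x x = 0 := by
  let restrict (B : LinearMap.BilinForm ℝ W) : Polynomial ℝ :=
    .C (B x x) + .C (B x v + B v x) * .X + .C (B v v) * .X ^ 2
  have eval_restrict (B : LinearMap.BilinForm ℝ W) (t : ℝ) :
      (restrict B).eval t = B (x + t • v) (x + t • v) := by
    simp [restrict]
    ring
  have hprod : restrict B * restrict B' = 0 := Polynomial.funext fun t => by
    rw [Polynomial.eval_mul, eval_restrict, eval_restrict, Polynomial.eval_zero, mul_eq_zero]
    exact or_iff_not_imp_right.2 (h _)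
  have hB' : restrict B' ≠ 0 := fun h0 => hv <| by
    simpa [restrict, Polynomial.coeff_X, Polynomial.coeff_C] using
      congrArg (Polynomial.coeff · 2) h0
  have hB : restrict B = 0 := (mul_eq_zero.1 hprod).resolve_right hB'
  simpa [hB] using (eval_restrict B 0).symm

/-- The `(0,4)`-tensors with the symmetries of a curvature tensor. Linearity in the other three
variables follows from these symmetries. -/
structure IsAlgebraicCurvature (T : W → W → W → W → ℝ) : Prop where
  add_left (x x' y z w : W) : T (x + x') y z w = T x y z w + T x' y z w
  smul_left (t : ℝ) (x y z w : W) : T (t • x) y z w = t * T x y z w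
  skew_left (x y z w : W) : T x y z w = -T y x z w
  skew_right (x y z w : W) : T x y z w = -T x y w z
  bianchi (x y z w : W) : T x y z w + T y z x w + T z x y w = 0

lemma isAlgebraicCurvature_of_isSymm {B : LinearMap.BilinForm ℝ W} (hB : B.IsSymm) :
    IsAlgebraicCurvature fun x y z w => B y z * B x w - B x z * B y w where
  add_left x x' y z w := by simp only [map_add, LinearMap.add_apply]; ring
  smul_left t x y z w := by simp only [map_smul, LinearMap.smul_apply, smul_eq_mul]; ring
  skew_left x y z w := by ring
  skew_right x y z w := by ring
  bianchi x y z w := by rw [hB.eq y x, hB.eq z x, hB.eq z y]; ring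

namespace IsAlgebraicCurvature

variable {T T' : W → W → W → W → ℝ}

lemma sub_const_mul (hT : IsAlgebraicCurvature T) (hT' : IsAlgebraicCurvature T') (c : ℝ) :
    IsAlgebraicCurvature fun x y z w => T x y z w - c * T' x y z w where
  add_left x x' y z w := by rw [hT.add_left, hT'.add_left]; ring
  smul_left t x y z w := by rw [hT.smul_left, hT'.smul_left]; ring
  skew_left x y z w := by rw [hT.skew_left, hT'.skew_left]; ring
  skew_right x y z w := by rw [hT.skew_right, hT'.skew_right]; ring
  bianchi x y z w := by linear_combination hT.bianchi x y z w - c * hT'.bianchi x y z w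

lemma pair_symm (hT : IsAlgebraicCurvature T) (x y z w : W) : T x y z w = T z w x y := by
  linarith [hT.bianchi x y z w, hT.bianchi y z w x, hT.bianchi z w x y, hT.bianchi w x y z,
    hT.skew_left x y z w, hT.skew_left y z w x, hT.skew_left z w x y, hT.skew_left w x y z,
    hT.skew_left x z y w, hT.skew_left y w x z, hT.skew_left x z w y, hT.skew_left y w z x,
    hT.skew_right x y z w, hT.skew_right y z x w, hT.skew_right z x y w, hT.skew_right z w x y,
    hT.skew_right w x y z, hT.skew_right y w z x, hT.skew_right x z w y, hT.skew_right w y z x]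

lemma swap_swap (hT : IsAlgebraicCurvature T) (x y z w : W) : T x y z w = T y x w z := by
  rw [hT.skew_left, hT.skew_right, neg_neg]

lemma add_mid_left (hT : IsAlgebraicCurvature T) (x y y' z w : W) :
    T x (y + y') z w = T x y z w + T x y' z w := by
  rw [hT.skew_left, hT.add_left, hT.skew_left x y, hT.skew_left x y', neg_add]

lemma add_mid_right (hT : IsAlgebraicCurvature T) (x y z z' w : W) :
    T x y (z + z') w = T x y z w + T x y z' w := by
  rw [hT.pair_symm, hT.add_left, hT.pair_symm x y z, hT.pair_symm x y z']

lemma reverse (hT : IsAlgebraicCurvature T) (x y z w : W) : T x y z w = T w z y x := by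
  rw [hT.pair_symm, hT.swap_swap]

/-- The symmetric bilinear form `(x, z) ↦ T x y y z`. -/
def jacobiForm (hT : IsAlgebraicCurvature T) (y : W) : LinearMap.BilinForm ℝ W :=
  LinearMap.mk₂ ℝ (fun x z => T x y y z) (fun _ _ _ => hT.add_left ..)
    (fun _ _ _ => hT.smul_left ..)
    (fun x z z' => by rw [hT.reverse, hT.add_left, hT.reverse x y y z, hT.reverse x y y z'])
    (fun t x z => by rw [hT.reverse, hT.smul_left, hT.reverse x y y z, smul_eq_mul])

lemma eq_zero_of_sectional_eq_zero (hT : IsAlgebraicCurvature T) (h : ∀ x y, T x y y x = 0)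
    (x y z w : W) : T x y z w = 0 := by
  have jacobi_eq_zero (x y z : W) : T x y y z = 0 := by
    have hxz : hT.jacobiForm y (x + z) (x + z) = 0 := h (x + z) y
    have hx : hT.jacobiForm y x x = 0 := h x y
    have hz : hT.jacobiForm y z z = 0 := h z y
    have hsymm : hT.jacobiForm y z x = hT.jacobiForm y x z := hT.reverse ..
    simp only [map_add, LinearMap.add_apply, hx, hz, hsymm] at hxz
    change hT.jacobiForm y x z = 0
    linarith
  have alternating (x y z w : W) : T x y z w = -T x z y w := by
    have hyz := jacobi_eq_zero x (y + z) w
    rw [hT.add_mid_left, hT.add_mid_right, hT.add_mid_right] at hyz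
    linarith [jacobi_eq_zero x y w, jacobi_eq_zero x z w]
  linarith [hT.bianchi x y z w, alternating x y z w, hT.skew_left x z y w, alternating y z x w,
    hT.skew_left y x z w]

/-- Nondegenerate planes are dense: a sectional curvature that vanishes where `T'` does not vanishes
everywhere. One vector of the plane is moved at a time. -/
theorem eq_zero_of_nondegenerate (hT : IsAlgebraicCurvature T) (hT' : IsAlgebraicCurvature T')
    (h : ∀ x y, T' x y y x ≠ 0 → T x y y x = 0) {v w : W} (hvw : T' v w w v ≠ 0) (x y z t : W) :
    T x y z t = 0 := by
  have hxy (x : W) (hx : T' x w w x ≠ 0) (y : W) : T x y y x = 0 := by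
    rw [hT.swap_swap]
    refine bilin_self_eq_zero (B := hT.jacobiForm x) (B' := hT'.jacobiForm x) (v := w)
      (fun y hy => ?_) (by rwa [hT'.swap_swap] at hx) y
    change T y x x y = 0
    rw [hT.swap_swap]
    exact h x y (by rwa [hT'.swap_swap])
  refine hT.eq_zero_of_sectional_eq_zero (fun x y => ?_) x y z t
  exact bilin_self_eq_zero (B := hT.jacobiForm y) (B' := hT'.jacobiForm w)
    (fun x hx => hxy x hx y) hvw x

end IsAlgebraicCurvature

end AlgebraicCurvature

section AmbientCurvature

variable [IsManifold 𝓘(ℝ, F) ∞ N] {g : SemiRiemannianMetric F N} {D : Connection F N}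
  {X X' Y Z W : VField F N} {p : N}

lemma SmoothField.add (hX : SmoothField X) (hY : SmoothField Y) : SmoothField (X + Y) :=
  ContMDiff.add_section hX hY

lemma SmoothField.const_smul (t : ℝ) (hX : SmoothField X) : SmoothField (t • X) :=
  ContMDiff.const_smul_section (a := t) hX

lemma SmoothField.mdifferentiableAt (hX : SmoothField X) (p : N) : MDiffAt (T% X) p :=
  (hX.near p).mdifferentiableAt

lemma SmoothField.mlieBracket [CompleteSpace F] (hX : SmoothField X) (hY : SmoothField Y) :
    SmoothField (mlieBracket 𝓘(ℝ, F) X Y) :=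
  fun p => ((hX.near p).mlieBracket (hY.near p)).contMDiffAt

lemma SmoothField.connection (hD : D.ContMDiffCovariantDerivative ∞) (hX : SmoothField X)
    (hY : SmoothField Y) : SmoothField fun q => D Y q (X q) := fun p =>
  have hDY := hD.contMDiff.contMDiff (σ := Y) (by simpa using! hY.contMDiffOn)
  ContMDiffAt.clm_bundle_apply (hDY.contMDiffAt univ_mem) (hX p)

variable (F N) in
/-- The real vector space `Γ(TN)` of smooth vector fields. -/
def smoothFields : Submodule ℝ (VField F N) where
  carrier := {X | SmoothField X}
  add_mem' hX hY := hX.add hY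
  zero_mem' := Bundle.contMDiff_zeroSection ℝ (TangentSpace 𝓘(ℝ, F) : N → Type _)
  smul_mem' t _ hX := hX.const_smul t

lemma connection_add (hY : SmoothField Y) (hZ : SmoothField Z) : D (Y + Z) = D Y + D Z :=
  funext fun p => D.isCovariantDerivativeOn.add (s := Set.univ) (hY.mdifferentiableAt p)
    (hZ.mdifferentiableAt p) trivial

lemma connection_const_smul (t : ℝ) (hY : SmoothField Y) : D (t • Y) = t • D Y :=
  funext fun p => D.isCovariantDerivativeOn.smul_const (s := Set.univ) t
    (hY.mdifferentiableAt p) trivial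

/-- The curvature operator of a linear connection on the ambient manifold. -/
abbrev connCurv (D : Connection F N) (X Y Z : VField F N) : VField F N :=
  curvatureOp (fun V W q => D W q (V q)) X Y Z

lemma connCurv_apply (p : N) : connCurv D X Y Z p =
    D (fun q => D Z q (Y q)) p (X p) - D (fun q => D Z q (X q)) p (Y p)
      - D Z p (mlieBracket 𝓘(ℝ, F) X Y p) := rfl

lemma connCurv_swap : connCurv D X Y Z p = -connCurv D Y X Z p := by
  rw [connCurv_apply, connCurv_apply, mlieBracket_swap_apply, map_neg]
  abel

section Linearity

variable [CompleteSpace F]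

lemma connCurv_add_left (hD : D.ContMDiffCovariantDerivative ∞) (hX : SmoothField X)
    (hX' : SmoothField X') (hZ : SmoothField Z) :
    connCurv D (X + X') Y Z p = connCurv D X Y Z p + connCurv D X' Y Z p := by
  have hZXX' : (fun q => D Z q ((X + X') q)) = (fun q => D Z q (X q)) + fun q => D Z q (X' q) :=
    funext fun q => map_add (D Z q) (X q) (X' q)
  rw [connCurv_apply, connCurv_apply, connCurv_apply, hZXX',
    connection_add (hX.connection hD hZ) (hX'.connection hD hZ),
    mlieBracket_add_left (hX.mdifferentiableAt p) (hX'.mdifferentiableAt p)]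
  simp only [Pi.add_apply, map_add, add_apply]
  abel

lemma connCurv_smul_left (hD : D.ContMDiffCovariantDerivative ∞) (t : ℝ) (hX : SmoothField X)
    (hZ : SmoothField Z) : connCurv D (t • X) Y Z p = t • connCurv D X Y Z p := by
  have hZX : (fun q => D Z q ((t • X) q)) = t • fun q => D Z q (X q) :=
    funext fun q => map_smul (D Z q) t (X q)
  rw [connCurv_apply, connCurv_apply, hZX, connection_const_smul t (hX.connection hD hZ),
    mlieBracket_const_smul_left (hX.mdifferentiableAt p)]
  simp only [Pi.smul_apply, map_smul, smul_apply, smul_sub]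

end Linearity

lemma SmoothField.metric (hX : SmoothField X) (hY : SmoothField Y) (p : N) :
    SmoothNear 𝓘(ℝ, F) 𝓘(ℝ, ℝ) (fun q => g.val q (X q) (Y q)) p :=
  SmoothAlongNear.metric (f := id) g (hX.near p) (hY.near p)

variable [FiniteDimensional ℝ F]

lemma IsLeviCivita.sub_eq_mlieBracket (hD : IsLeviCivita g D) (hX : SmoothField X)
    (hY : SmoothField Y) (p : N) :
    D Y p (X p) - D X p (Y p) = mlieBracket 𝓘(ℝ, F) X Y p :=
  D.torsion_eq_zero_iff.1 hD.torsion_eq_zero (hX.mdifferentiableAt p) (hY.mdifferentiableAt p)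

lemma IsLeviCivita.connection_sub_connection (hD : IsLeviCivita g D) (hX : SmoothField X)
    (hY : SmoothField Y) (hZ : SmoothField Z) (p : N) :
    D (fun q => D Z q (Y q)) p (X p) - D (fun q => D Y q (Z q)) p (X p) =
      mlieBracket 𝓘(ℝ, F) X (mlieBracket 𝓘(ℝ, F) Y Z) p
        + D X p (mlieBracket 𝓘(ℝ, F) Y Z p) := by
  have hYZ := hY.mlieBracket hZ
  have hDZ : (fun q => D Z q (Y q)) = (fun q => D Y q (Z q)) + mlieBracket 𝓘(ℝ, F) Y Z :=
    funext fun q => sub_eq_iff_eq_add'.1 (hD.sub_eq_mlieBracket hY hZ q)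
  rw [hDZ, connection_add (hZ.connection hD.smooth hY) hYZ, ← hD.sub_eq_mlieBracket hX hYZ]
  simp only [Pi.add_apply, add_apply]
  abel

lemma mlieBracket_cyclic_eq_zero (hX : SmoothField X) (hY : SmoothField Y) (hZ : SmoothField Z)
    (p : N) :
    mlieBracket 𝓘(ℝ, F) X (mlieBracket 𝓘(ℝ, F) Y Z) p
      + mlieBracket 𝓘(ℝ, F) Y (mlieBracket 𝓘(ℝ, F) Z X) p
      + mlieBracket 𝓘(ℝ, F) Z (mlieBracket 𝓘(ℝ, F) X Y) p = 0 := by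
  have : IsManifold 𝓘(ℝ, F) (minSmoothness ℝ 3) N := by
    rw [minSmoothness_of_isRCLikeNormedField]
    exact IsManifold.of_le (n := ∞) (by norm_cast)
  have smooth {W : VField F N} (hW : SmoothField W) :
      CMDiffAt (minSmoothness ℝ 2) (T% W) p := by
    rw [minSmoothness_of_isRCLikeNormedField]
    exact (hW p).of_le (by norm_cast)
  have hXZ : mlieBracket 𝓘(ℝ, F) X Z = (-1 : ℝ) • mlieBracket 𝓘(ℝ, F) Z X := by
    rw [mlieBracket_swap, neg_one_smul]
  rw [leibniz_identity_mlieBracket_apply (smooth hX) (smooth hY) (smooth hZ), hXZ,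
    mlieBracket_const_smul_right ((hZ.mlieBracket hX).mdifferentiableAt p),
    mlieBracket_swap_apply (V := mlieBracket 𝓘(ℝ, F) X Y)]
  module

lemma connCurv_bianchi (hD : IsLeviCivita g D) (hX : SmoothField X) (hY : SmoothField Y)
    (hZ : SmoothField Z) :
    connCurv D X Y Z p + connCurv D Y Z X p + connCurv D Z X Y p = 0 := by
  rw [connCurv_apply, connCurv_apply, connCurv_apply]
  linear_combination (norm := module)
    hD.connection_sub_connection hX hY hZ p + hD.connection_sub_connection hY hZ hX p
      + hD.connection_sub_connection hZ hX hY p + mlieBracket_cyclic_eq_zero hX hY hZ p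

lemma IsLeviCivita.mvfderiv_mvfderiv_metric (hD : IsLeviCivita g D) (X : VField F N)
    (hY : SmoothField Y) (hZ : SmoothField Z) (hW : SmoothField W) (p : N) :
    d% (fun q => d% (fun q => g.val q (Z q) (W q)) q (Y q)) p (X p) =
      (g.val p (D (fun q => D Z q (Y q)) p (X p)) (W p) + g.val p (D Z p (Y p)) (D W p (X p)))
        + (g.val p (D Z p (X p)) (D W p (Y p))
          + g.val p (Z p) (D (fun q => D W q (Y q)) p (X p))) := by
  have metric {V V' : VField F N} (hV : SmoothField V) (hV' : SmoothField V') (q : N) :=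
    hD.metric V V' q (hV.mdifferentiableAt q) (hV'.mdifferentiableAt q)
  have hYZ := hY.connection hD.smooth hZ
  have hYW := hY.connection hD.smooth hW
  have hderiv : (fun q => d% (fun q => g.val q (Z q) (W q)) q (Y q)) =
      (fun q => g.val q (D Z q (Y q)) (W q)) + fun q => g.val q (Z q) (D W q (Y q)) :=
    funext fun q => metric hZ hW q (Y q)
  rw [hderiv, mvfderiv_add (hYZ.metric hW p).mdifferentiableAt
    (hZ.metric hYW p).mdifferentiableAt, add_apply, metric hYZ hW, metric hZ hYW]

lemma connCurv_metric_skew (hD : IsLeviCivita g D) (hX : SmoothField X) (hY : SmoothField Y)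
    (hZ : SmoothField Z) (hW : SmoothField W) :
    g.val p (connCurv D X Y Z p) (W p) = -g.val p (connCurv D X Y W p) (Z p) := by
  have hXY := mvfderiv_mlieBracket (hZ.metric (g := g) hW p) (hX.near p) (hY.near p)
  rw [hD.mvfderiv_mvfderiv_metric X hY hZ hW, hD.mvfderiv_mvfderiv_metric Y hX hZ hW,
    hD.metric Z W p (hZ.mdifferentiableAt p) (hW.mdifferentiableAt p)] at hXY
  rw [g.symm p _ (Z p), connCurv_apply, connCurv_apply]
  simp only [map_sub, sub_apply]
  linarith

lemma isAlgebraicCurvature_connCurv (hD : IsLeviCivita g D) (p : N) :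
    IsAlgebraicCurvature fun X Y Z W : smoothFields F N =>
      g.val p (connCurv D X Y Z p) (W.1 p) where
  add_left X X' Y Z W := by
    rw [Submodule.coe_add, connCurv_add_left hD.smooth X.2 X'.2 Z.2, map_add, add_apply]
  smul_left t X Y Z W := by
    rw [Submodule.coe_smul, connCurv_smul_left hD.smooth t X.2 Z.2, map_smul, smul_apply,
      smul_eq_mul]
  skew_left X Y Z W := by rw [connCurv_swap, map_neg, neg_apply]
  skew_right X Y Z W := connCurv_metric_skew hD X.2 Y.2 Z.2 W.2
  bianchi X Y Z W := by
    rw [← add_apply, ← map_add, ← add_apply, ← map_add, connCurv_bianchi hD X.2 Y.2 Z.2, map_zero,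
      zero_apply]

variable (g) in
/-- The metric at `p` as a bilinear form on `Γ(TN)`. -/
def metricFormAt (p : N) : LinearMap.BilinForm ℝ (smoothFields F N) :=
  (toBilin (g.val p)).comp (LinearMap.proj p ∘ₗ (smoothFields F N).subtype)
    (LinearMap.proj p ∘ₗ (smoothFields F N).subtype)

/-- The algebraic curvature tensors `g(R(X,Y)Z,W)` and `c` times the constant curvature tensor
agree on nondegenerate planes, hence everywhere. -/
theorem HasConstantSectionalCurvature.connCurv_eq [T2Space N] (hD : IsLeviCivita g D) {c : ℝ}
    (hc : HasConstantSectionalCurvature g D c)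
    (hp : ∃ v w : TangentSpace 𝓘(ℝ, F) p, g.val p v v * g.val p w w - g.val p v w ^ 2 ≠ 0)
    (hX : SmoothField X) (hY : SmoothField Y) (hZ : SmoothField Z) :
    connCurv D X Y Z p = c • (g.val p (Y p) (Z p) • X p - g.val p (X p) (Z p) • Y p) := by
  obtain ⟨v, w, hvw⟩ := hp
  obtain ⟨V, hV, rfl⟩ := exists_smoothField_eq v
  obtain ⟨W, hW, rfl⟩ := exists_smoothField_eq w
  have hT := isAlgebraicCurvature_connCurv hD p
  have hT' := isAlgebraicCurvature_of_isSymm (B := metricFormAt g p) ⟨fun X Y => g.symm p _ _⟩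
  have area (X Y : VField F N) : g.val p (Y p) (Y p) * g.val p (X p) (X p)
      - g.val p (X p) (Y p) * g.val p (Y p) (X p) =
        g.val p (X p) (X p) * g.val p (Y p) (Y p) - g.val p (X p) (Y p) ^ 2 := by
    rw [g.symm p (Y p) (X p)]
    ring
  refine sub_eq_zero.1 (g.nondegenerate p _ fun y => ?_)
  obtain ⟨T, hT₀, rfl⟩ := exists_smoothField_eq y
  have hTT' := (hT.sub_const_mul hT' c).eq_zero_of_nondegenerate hT' (v := ⟨V, hV⟩) (w := ⟨W, hW⟩)
    (fun X Y hXY => ?_) ((area V W).trans_ne hvw) ⟨X, hX⟩ ⟨Y, hY⟩ ⟨Z, hZ⟩ ⟨T, hT₀⟩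
  · simp only [map_sub, map_smul, sub_apply, smul_apply, smul_eq_mul]
    exact hTT'
  · have hXY' := (area X Y).symm.trans_ne hXY
    refine sub_eq_zero.2 (((div_eq_iff hXY').1 (hc X Y X.2 Y.2 p hXY')).trans ?_)
    rw [← area]
    rfl

end AmbientCurvature

section ConnectionAlong

variable [FiniteDimensional ℝ F] [IsManifold 𝓘(ℝ, F) ∞ N] {g : SemiRiemannianMetric F N}
  {D : Connection F N} {f : M → N} {u : M} {X Y : VField E M}

lemma covAlong_covAlong {V : Π u : M, TangentSpace 𝓘(ℝ, F) (f u)} {X' Y' Z : VField F N}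
    (hD : CovariantDerivative.ContMDiffCovariantDerivative D ∞)
    (hf : SmoothNear 𝓘(ℝ, E) 𝓘(ℝ, F) f u) (hY' : SmoothField Y') (hZ : SmoothField Z)
    (hXX' : ∀ᶠ x in 𝓝 u, X' (f x) = pushAlong F f X x)
    (hYY' : ∀ᶠ x in 𝓝 u, Y' (f x) = pushAlong F f Y x) (hZV : ∀ᶠ x in 𝓝 u, Z (f x) = V x) :
    covAlong D f (fun x => covAlong D f V x (Y x)) u (X u) =
      D (fun q => D Z q (Y' q)) (f u) (X' (f u)) := by
  have hDZ : ∀ᶠ x in 𝓝 u, D Z (f x) (Y' (f x)) = covAlong D f V x (Y x) := by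
    filter_upwards [hYY', hZV.eventually_nhds, hf.eventually] with x hYx hZx hfx
    rw [covAlong_eq_of_eventuallyEq hZ hfx.mdifferentiableAt hZx, hYx]
  rw [covAlong_eq_of_eventuallyEq (hY'.connection hD hZ) hf.mdifferentiableAt hDZ,
    hXX'.self_of_nhds]

variable [FiniteDimensional ℝ E] [IsManifold 𝓘(ℝ, E) ∞ M] [T2Space N]

lemma IsLeviCivita.covAlong_sub_covAlong (hD : IsLeviCivita g D)
    (hf : SmoothNear 𝓘(ℝ, E) 𝓘(ℝ, F) f u) (hinj : Function.Injective (mfderiv% f u))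
    (hX : SmoothFieldNear X u) (hY : SmoothFieldNear Y u) :
    covAlong D f (pushAlong F f Y) u (X u) - covAlong D f (pushAlong F f X) u (Y u) =
      mfderiv% f u (mlieBracket 𝓘(ℝ, E) X Y u) := by
  have : CompleteSpace E := FiniteDimensional.complete ℝ E
  have : CompleteSpace F := FiniteDimensional.complete ℝ F
  obtain ⟨X', hX', hXX'⟩ := (smoothAlongNear_pushAlong hX hf).exists_smoothField hinj
  obtain ⟨Y', hY', hYY'⟩ := (smoothAlongNear_pushAlong hY hf).exists_smoothField hinj
  rw [mfderiv_mlieBracket_of_related hf hX hY (hX'.near _) (hY'.near _) hXX' hYY',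
    ← hD.sub_eq_mlieBracket hX' hY', hXX'.self_of_nhds, hYY'.self_of_nhds,
    covAlong_eq_of_eventuallyEq hX' hf.mdifferentiableAt hXX',
    covAlong_eq_of_eventuallyEq hY' hf.mdifferentiableAt hYY']

theorem HasConstantSectionalCurvature.curvature_along (hD : IsLeviCivita g D) {c : ℝ}
    (hc : HasConstantSectionalCurvature g D c)
    (hp : ∃ v w : TangentSpace 𝓘(ℝ, F) (f u),
      g.val (f u) v v * g.val (f u) w w - g.val (f u) v w ^ 2 ≠ 0)
    (hinj : Function.Injective (mfderiv% f u)) (hX : SmoothFieldNear X u)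
    (hY : SmoothFieldNear Y u) {V : Π u : M, TangentSpace 𝓘(ℝ, F) (f u)}
    (hV : SmoothAlongNear E f V u) :
    covAlong D f (fun x => covAlong D f V x (Y x)) u (X u)
        - covAlong D f (fun x => covAlong D f V x (X x)) u (Y u)
        - covAlong D f V u (mlieBracket 𝓘(ℝ, E) X Y u) =
      c • (g.val (f u) (pushAlong F f Y u) (V u) • pushAlong F f X u
        - g.val (f u) (pushAlong F f X u) (V u) • pushAlong F f Y u) := by
  have : CompleteSpace E := FiniteDimensional.complete ℝ E
  have : CompleteSpace F := FiniteDimensional.complete ℝ F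
  have hf := hV.smoothNear
  obtain ⟨X', hX', hXX'⟩ := (smoothAlongNear_pushAlong hX hf).exists_smoothField hinj
  obtain ⟨Y', hY', hYY'⟩ := (smoothAlongNear_pushAlong hY hf).exists_smoothField hinj
  obtain ⟨Z, hZ, hZV⟩ := hV.exists_smoothField hinj
  rw [covAlong_covAlong hD.smooth hf hY' hZ hXX' hYY' hZV,
    covAlong_covAlong hD.smooth hf hX' hZ hYY' hXX' hZV,
    covAlong_eq_of_eventuallyEq hZ hf.mdifferentiableAt hZV,
    mfderiv_mlieBracket_of_related hf hX hY (hX'.near _) (hY'.near _) hXX' hYY',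
    ← hXX'.self_of_nhds, ← hYY'.self_of_nhds, ← hZV.self_of_nhds, ← connCurv_apply]
  exact hc.connCurv_eq hD hp hX' hY' hZ

lemma SmoothFieldNear.of_pushAlong (hinj : Function.Injective (mfderiv% f u))
    (hY : SmoothAlongNear E f (pushAlong F f Y) u) : SmoothFieldNear Y u := by
  obtain ⟨W, hW, hWY⟩ := hY.exists_smoothField hinj
  obtain ⟨r, hr, hrf⟩ := hY.smoothNear.exists_leftInverse hinj
  have hdrW : SmoothNear 𝓘(ℝ, E) 𝓘(ℝ, E).tangent
      (fun x => (⟨r (f x), mfderiv% r (f x) (W (f x))⟩ : TangentBundle 𝓘(ℝ, E) M)) u :=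
    SmoothNear.comp (smoothAlongNear_pushAlong (hW.near (f u)) hr) hY.smoothNear
  have hrfu : ∀ᶠ x in 𝓝 u, SmoothNear 𝓘(ℝ, F) 𝓘(ℝ, E) r (f x) :=
    hY.smoothNear.contMDiffAt.continuousAt.eventually hr.eventually
  refine hdrW.congr ?_
  filter_upwards [hrf.eventually_nhds, hWY, hrfu, hY.smoothNear.eventually] with x hx hWx hrx hfx
  have hcomp := mfderiv_comp_apply x hrx.mdifferentiableAt hfx.mdifferentiableAt (Y x)
  have hid : mfderiv% (r ∘ f) x = mfderiv% (id : M → M) x := Filter.EventuallyEq.mfderiv_eq hx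
  refine TotalSpace.ext hx.self_of_nhds (heq_of_eq ?_)
  rw [hWx]
  refine hcomp.symm.trans ?_
  rw [hid, mfderiv_id]
  rfl

end ConnectionAlong

section NormalizingPair

variable [IsManifold 𝓘(ℝ, F) ∞ N] {g : SemiRiemannianMetric F N}
  {f : M → N} {S : Π u : M, Submodule ℝ (TangentSpace 𝓘(ℝ, E) u)} {u : M}
  {ξ ξ' x : TangentSpace 𝓘(ℝ, E) u} {n n' w : TangentSpace 𝓘(ℝ, F) (f u)}

lemma metric_mfderiv_radical (hξ : ξ ∈ radical g f u) (x : TangentSpace 𝓘(ℝ, E) u) :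
    g.val (f u) (mfderiv% f u x) (mfderiv% f u ξ) = 0 := by
  rw [g.symm]
  exact hξ x

lemma IsNormalizingPairAt.ne_zero (hp : IsNormalizingPairAt g f S u ξ n) : ξ ≠ 0 := by
  rintro rfl
  simpa using hp.pairing

variable [IsManifold 𝓘(ℝ, E) ∞ M]

lemma IsLightlikeHypersurface.exists_eq_smul_of_mem_radical
    (hf : IsLightlikeHypersurface (E := E) g f) (hξ : ξ ∈ radical g f u) (hξ0 : ξ ≠ 0)
    (hx : x ∈ radical g f u) : ∃ b : ℝ, x = b • ξ := by
  obtain ⟨U, -, huU, X, -, hX⟩ := hf.radical_rank_one u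
  have hspan : _ = radical g f u := (hX u huU).2
  rw [Set.range_unique] at hspan
  rw [← hspan, Submodule.mem_span_singleton] at hξ hx
  obtain ⟨a, rfl⟩ := hξ
  obtain ⟨b, rfl⟩ := hx
  have ha : a ≠ 0 := by
    rintro rfl
    exact hξ0 (zero_smul _ _)
  exact ⟨b / a, by rw [smul_smul, div_mul_cancel₀ _ ha]⟩

lemma IsScreen.mem_radical (hS : IsScreen g f S)
    (hx : ∀ s ∈ S u, indMetric g f u x s = 0) : x ∈ radical g f u := by
  intro y
  have hy : y ∈ radical g f u ⊔ S u := (hS.2 u).sup_eq_top ▸ Submodule.mem_top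
  obtain ⟨r, hr, s, hs, rfl⟩ := Submodule.mem_sup.1 hy
  rw [indMetric, map_add, map_add, metric_mfderiv_radical hr, zero_add]
  exact hx s hs

section CodimensionOne

variable [FiniteDimensional ℝ F]

lemma IsNormalizingPairAt.exists_mfderiv_eq_sub (hf : IsLightlikeHypersurface (E := E) g f)
    (hp : IsNormalizingPairAt g f S u ξ n) (w : TangentSpace 𝓘(ℝ, F) (f u)) :
    ∃ x : TangentSpace 𝓘(ℝ, E) u,
      mfderiv% f u x = w - g.val (f u) w (mfderiv% f u ξ) • n := by
  let df : TangentSpace 𝓘(ℝ, E) u →ₗ[ℝ] TangentSpace 𝓘(ℝ, F) (f u) := (mfderiv% f u).toLinearMap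
  let φ : TangentSpace 𝓘(ℝ, F) (f u) →ₗ[ℝ] ℝ := (g.val (f u) (mfderiv% f u ξ)).toLinearMap
  have hφ : ∀ v, φ v = g.val (f u) v (mfderiv% f u ξ) := fun v => g.symm _ _ _
  have hφn : φ n = 1 := (hφ n).trans hp.pairing
  have hφ0 : φ ≠ 0 := by
    intro h
    rw [h] at hφn
    exact zero_ne_one hφn
  have hle : LinearMap.range df ≤ LinearMap.ker φ := by
    rintro _ ⟨x, rfl⟩
    exact hp.mem_radical x
  have hrange : Module.finrank ℝ (LinearMap.range df) = Module.finrank ℝ E :=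
    LinearMap.finrank_range_of_inj (hf.immersion u)
  have hker := Module.Dual.finrank_ker_add_one_of_ne_zero hφ0
  have hcodim : Module.finrank ℝ (TangentSpace 𝓘(ℝ, F) (f u)) = Module.finrank ℝ E + 1 :=
    hf.codim_one
  have hmem : w - φ w • n ∈ LinearMap.range df := by
    rw [Submodule.eq_of_le_of_finrank_eq hle (by omega), LinearMap.mem_ker, map_sub, map_smul, hφn,
      smul_eq_mul, mul_one, sub_self]
  rwa [hφ] at hmem

theorem IsNormalizingPairAt.eq_smul (hf : IsLightlikeHypersurface (E := E) g f)
    (hS : IsScreen g f S) (hp : IsNormalizingPairAt g f S u ξ n)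
    (hp' : IsNormalizingPairAt g f S u ξ' n') : ∃ a : ℝ, n' = a • n := by
  obtain ⟨x, hx⟩ := hp.exists_mfderiv_eq_sub hf n'
  set a := g.val (f u) n' (mfderiv% f u ξ)
  have hrad : x ∈ radical g f u := hS.mem_radical fun s hs => by
    rw [indMetric, hx, map_sub, map_smul, sub_apply, smul_apply, hp'.orthogonal s hs,
      hp.orthogonal s hs, smul_zero, sub_zero]
  obtain ⟨b, rfl⟩ := hf.exists_eq_smul_of_mem_radical hp.mem_radical hp.ne_zero hrad
  have hn' : n' = b • mfderiv% f u ξ + a • n := by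
    rw [← map_smul, hx, sub_add_cancel]
  have hξξ := metric_mfderiv_radical hp.mem_radical ξ
  have ha : a ≠ 0 := by
    intro ha
    have hpair := hp'.pairing
    rw [hn', ha, zero_smul, add_zero, map_smul, smul_apply, g.symm,
      metric_mfderiv_radical hp.mem_radical, smul_zero] at hpair
    exact zero_ne_one hpair
  have hab : a * b = 0 := by
    have hnull := hp'.null
    rw [hn'] at hnull
    simp only [map_add, map_smul, add_apply, smul_apply, smul_eq_mul, hp.null, hξξ, hp.pairing,
      g.symm (f u) (mfderiv% f u ξ) n] at hnull
    linarith
  have hb : b = 0 := (mul_eq_zero.1 hab).resolve_left ha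
  exact ⟨a, by rw [hn', hb, zero_smul, zero_add]⟩

theorem IsNormalizingPairAt.mfderiv_tanPart (hf : IsLightlikeHypersurface (E := E) g f)
    (hS : IsScreen g f S) (hp : IsNormalizingPairAt g f S u ξ n)
    (w : TangentSpace 𝓘(ℝ, F) (f u)) :
    mfderiv% f u (tanPart g f S u w) = w - g.val (f u) w (mfderiv% f u ξ) • n := by
  have hspan : transversal g f S u ≤ Submodule.span ℝ {n} := by
    refine Submodule.span_le.2 ?_
    rintro n' ⟨ξ', hp'⟩
    obtain ⟨a, rfl⟩ := hp.eq_smul hf hS hp'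
    exact Submodule.smul_mem _ _ (Submodule.mem_span_singleton_self n)
  have hex : ∃ x, w - mfderiv% f u x ∈ transversal g f S u := by
    obtain ⟨x, hx⟩ := hp.exists_mfderiv_eq_sub hf w
    refine ⟨x, ?_⟩
    rw [hx, sub_sub_cancel]
    exact Submodule.smul_mem _ _ (Submodule.subset_span ⟨ξ, hp⟩)
  obtain ⟨a, ha⟩ : ∃ a : ℝ, a • n = w - mfderiv% f u (tanPart g f S u w) :=
    Submodule.mem_span_singleton.1 (hspan (Classical.epsilon_spec hex))
  have hcoef : a = g.val (f u) w (mfderiv% f u ξ) := by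
    have hpair := congrArg (fun v => g.val (f u) v (mfderiv% f u ξ)) ha
    simpa only [map_smul, map_sub, smul_apply, sub_apply, metric_mfderiv_radical hp.mem_radical,
      hp.pairing, smul_eq_mul, mul_one, sub_zero] using hpair
  rw [← hcoef, ha, sub_sub_cancel]

lemma IsNormalizingPairAt.tanPart_transversal (hf : IsLightlikeHypersurface (E := E) g f)
    (hS : IsScreen g f S) (hp : IsNormalizingPairAt g f S u ξ n) : tanPart g f S u n = 0 := by
  apply hf.immersion u
  rw [hp.mfderiv_tanPart hf hS, hp.pairing, one_smul, sub_self, map_zero]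

lemma IsNormalizingPairAt.tanPart_mfderiv (hf : IsLightlikeHypersurface (E := E) g f)
    (hS : IsScreen g f S) (hp : IsNormalizingPairAt g f S u ξ n) (x : TangentSpace 𝓘(ℝ, E) u) :
    tanPart g f S u (mfderiv% f u x) = x := by
  apply hf.immersion u
  rw [hp.mfderiv_tanPart hf hS, metric_mfderiv_radical hp.mem_radical, zero_smul, sub_zero]

/-- The projection `T_{f u} N = df(T_u M) ⊕ tr(TM)_u → T_u M` as a linear map. -/
def IsNormalizingPairAt.tanProj (hf : IsLightlikeHypersurface (E := E) g f)
    (hS : IsScreen g f S) (hp : IsNormalizingPairAt g f S u ξ n) :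
    TangentSpace 𝓘(ℝ, F) (f u) →ₗ[ℝ] TangentSpace 𝓘(ℝ, E) u where
  toFun := tanPart g f S u
  map_add' v w := hf.immersion u <| by
    simp only [map_add, hp.mfderiv_tanPart hf hS, add_apply]
    module
  map_smul' t w := hf.immersion u <| by
    simp only [map_smul, hp.mfderiv_tanPart hf hS, smul_apply, RingHom.id_apply, smul_eq_mul]
    module

end CodimensionOne

end NormalizingPair

section GaussEquation

/-- `(ξ, n)` is a smooth normalizing pair of the screen `S` on a neighbourhood of `u`. -/
structure IsNormalizingPairNear [IsManifold 𝓘(ℝ, E) ∞ M] [IsManifold 𝓘(ℝ, F) ∞ N]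
    (g : SemiRiemannianMetric F N) (f : M → N)
    (S : Π u : M, Submodule ℝ (TangentSpace 𝓘(ℝ, E) u)) (ξ : VField E M)
    (n : Π u : M, TangentSpace 𝓘(ℝ, F) (f u)) (u : M) : Prop where
  smooth_radical : SmoothFieldNear ξ u
  smooth_transversal : SmoothAlongNear E f n u
  pair : ∀ᶠ x in 𝓝 u, IsNormalizingPairAt g f S x (ξ x) (n x)

/-- The local second fundamental form `B(Y, Z) = g(∇̄_Y Z, ξ)` of the hypersurface, relative to the
section `ξ` of the radical; it is the coefficient of `N` in the Gauss formula. -/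
def secondForm [IsManifold 𝓘(ℝ, F) ∞ N] (g : SemiRiemannianMetric F N) (D : Connection F N)
    (f : M → N) (ξ Y Z : VField E M) (u : M) : ℝ :=
  g.val (f u) (covAlong D f (pushAlong F f Z) u (Y u)) (pushAlong F f ξ u)

variable [IsManifold 𝓘(ℝ, F) ∞ N] {g : SemiRiemannianMetric F N}
  {D : Connection F N} {f : M → N} {S : Π u : M, Submodule ℝ (TangentSpace 𝓘(ℝ, E) u)} {u : M}
  {ξ : VField E M} {n : Π u : M, TangentSpace 𝓘(ℝ, F) (f u)} {X Y Z : VField E M}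

lemma secondForm_congr {Y' Z' : VField E M} (hY : ∀ᶠ x in 𝓝 u, Y' x = Y x)
    (hZ : ∀ᶠ x in 𝓝 u, Z' x = Z x) :
    secondForm g D f ξ Y' Z' u = secondForm g D f ξ Y Z u := by
  have hdfZ : ∀ᶠ x in 𝓝 u, pushAlong F f Z' x = pushAlong F f Z x :=
    hZ.mono fun x hx => congrArg _ hx
  rw [secondForm, secondForm, covAlong_congr hdfZ, hY.self_of_nhds]

variable [IsManifold 𝓘(ℝ, E) ∞ M]

lemma IsLightlikeHypersurface.smoothNear (hf : IsLightlikeHypersurface (E := E) g f) (u : M) :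
    SmoothNear 𝓘(ℝ, E) 𝓘(ℝ, F) f u :=
  .of_forall fun x => hf.smooth x

lemma IsLightlikeHypersurface.smoothAlongNear_pushAlong (hf : IsLightlikeHypersurface (E := E) g f)
    (hX : SmoothFieldNear X u) : SmoothAlongNear E f (pushAlong F f X) u :=
  LightlikeGeometry.smoothAlongNear_pushAlong hX (hf.smoothNear u)

lemma ShapeXiNonNull.exists_near (hA : ShapeXiNonNull g D f S) (u : M) :
    ∃ (ξ : VField E M) (n : Π u : M, TangentSpace 𝓘(ℝ, F) (f u)),
      IsNormalizingPairNear g f S ξ n u ∧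
      indMetric g f u (shapeOp g D f S n u (ξ u)) (shapeOp g D f S n u (ξ u)) ≠ 0 := by
  obtain ⟨U, hU, huU, ξ, n, hξ, hn, h⟩ := hA u
  have hU' : ∀ᶠ x in 𝓝 u, x ∈ U := hU.mem_nhds huU
  refine ⟨ξ, n, ⟨?_, ?_, hU'.mono fun x hx => (h x hx).1⟩, (h u huU).2⟩
  · exact hU'.mono fun x hx => (hξ x hx).contMDiffAt (hU.mem_nhds hx)
  · exact hU'.mono fun x hx => (hn x hx).contMDiffAt (hU.mem_nhds hx)

lemma IsNormalizingPairNear.exists_smoothField [FiniteDimensional ℝ E] [T2Space M]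
    (hp : IsNormalizingPairNear g f S ξ n u) :
    ∃ ξ' : VField E M, SmoothField ξ' ∧ ξ' u = ξ u ∧ IsNormalizingPairNear g f S ξ' n u := by
  obtain ⟨ξ', hξ', hξξ'⟩ := hp.smooth_radical.exists_smoothField
  refine ⟨ξ', hξ', hξξ'.self_of_nhds, hξ'.near u, hp.smooth_transversal, ?_⟩
  filter_upwards [hξξ', hp.pair] with x hx hpx
  rwa [hx]

variable [FiniteDimensional ℝ F]

lemma IsNormalizingPairAt.pushAlong_indConn (hf : IsLightlikeHypersurface (E := E) g f)
    (hS : IsScreen g f S) (hp : IsNormalizingPairAt g f S u (ξ u) (n u)) (Y Z : VField E M) :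
    mfderiv% f u (indConn g D f S Y Z u) =
      covAlong D f (pushAlong F f Z) u (Y u) - secondForm g D f ξ Y Z u • n u :=
  hp.mfderiv_tanPart hf hS _

variable [FiniteDimensional ℝ E] [T2Space N]

lemma IsNormalizingPairNear.secondForm_radical_right (hD : IsLeviCivita g D)
    (hf : IsLightlikeHypersurface (E := E) g f) (hp : IsNormalizingPairNear g f S ξ n u)
    (Y : VField E M) : secondForm g D f ξ Y ξ u = 0 := by
  have hdfξ := hf.smoothAlongNear_pushAlong hp.smooth_radical
  have hnull : (fun x => g.val (f x) (pushAlong F f ξ x) (pushAlong F f ξ x)) =ᶠ[𝓝 u]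
      fun _ => 0 := hp.pair.mono fun x hx => hx.mem_radical _
  have hderiv := mvfderiv_metric hD hdfξ hdfξ (hf.immersion u) (Y u)
  rw [mvfderiv_congr_of_eventuallyEq hnull, mvfderiv_const, zero_apply,
    g.symm _ (pushAlong F f ξ u)] at hderiv
  rw [secondForm]
  linarith

lemma IsNormalizingPairNear.secondForm_radical_left (hD : IsLeviCivita g D)
    (hf : IsLightlikeHypersurface (E := E) g f) (hp : IsNormalizingPairNear g f S ξ n u)
    (hZ : SmoothFieldNear Z u) : secondForm g D f ξ ξ Z u = 0 := by
  have htorsion := hD.covAlong_sub_covAlong (hf.smoothNear u) (hf.immersion u) hp.smooth_radical hZ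
  rw [← hp.secondForm_radical_right hD hf Z, ← sub_eq_zero, secondForm, secondForm, ← sub_apply,
    ← map_sub, htorsion]
  exact metric_mfderiv_radical hp.pair.self_of_nhds.mem_radical _

lemma IsNormalizingPairNear.exists_covAlong_indConn (hD : IsLeviCivita g D)
    (hf : IsLightlikeHypersurface (E := E) g f) (hS : IsScreen g f S)
    (hp : IsNormalizingPairNear g f S ξ n u) (hY : SmoothFieldNear Y u)
    (hZ : SmoothFieldNear Z u) (w : TangentSpace 𝓘(ℝ, E) u) :
    ∃ t : ℝ, covAlong D f (pushAlong F f (indConn g D f S Y Z)) u w =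
      covAlong D f (fun x => covAlong D f (pushAlong F f Z) x (Y x)) u w
        - secondForm g D f ξ Y Z u • covAlong D f n u w + t • n u := by
  have hinj := hf.immersion u
  have hDYZ := SmoothAlongNear.covAlong_apply hD.smooth hY (hf.smoothAlongNear_pushAlong hZ) hinj
  have hB : SmoothNear 𝓘(ℝ, E) 𝓘(ℝ, ℝ) (fun x => -secondForm g D f ξ Y Z x) u :=
    (hDYZ.metric g (hf.smoothAlongNear_pushAlong hp.smooth_radical)).mono fun x hx => hx.neg
  have hgauss : ∀ᶠ x in 𝓝 u, pushAlong F f (indConn g D f S Y Z) x =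
      ((fun x => covAlong D f (pushAlong F f Z) x (Y x))
        + (fun x => -secondForm g D f ξ Y Z x) • n) x := by
    filter_upwards [hp.pair] with x hx
    rw [pushAlong, hx.pushAlong_indConn hf hS, Pi.add_apply, Pi.smul_apply', neg_smul,
      sub_eq_add_neg]
  refine ⟨d% (fun x => -secondForm g D f ξ Y Z x) u w, ?_⟩
  rw [covAlong_congr hgauss, covAlong_add hDYZ (SmoothAlongNear.smul hp.smooth_transversal hB) hinj,
    covAlong_smul hB.mdifferentiableAt hp.smooth_transversal hinj]
  module

theorem IsNormalizingPairNear.gauss_equation (hD : IsLeviCivita g D) {c : ℝ}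
    (hc : HasConstantSectionalCurvature g D c) (hf : IsLightlikeHypersurface (E := E) g f)
    (hS : IsScreen g f S) (hp : IsNormalizingPairNear g f S ξ n u) (hX : SmoothFieldNear X u)
    (hY : SmoothFieldNear Y u) (hZ : SmoothFieldNear Z u) :
    indCurv g D f S X Y Z u =
      c • (indMetric g f u (Y u) (Z u) • X u - indMetric g f u (X u) (Z u) • Y u)
        + secondForm g D f ξ Y Z u • shapeOp g D f S n u (X u)
        - secondForm g D f ξ X Z u • shapeOp g D f S n u (Y u) := by
  have hpu := hp.pair.self_of_nhds
  have hplane : ∃ v w : TangentSpace 𝓘(ℝ, F) (f u),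
      g.val (f u) v v * g.val (f u) w w - g.val (f u) v w ^ 2 ≠ 0 :=
    ⟨n u, mfderiv% f u (ξ u), by rw [hpu.null, hpu.pairing]; norm_num⟩
  have hcurv := hc.curvature_along hD hplane (hf.immersion u) hX hY
    (hf.smoothAlongNear_pushAlong hZ)
  obtain ⟨a, ha⟩ := hp.exists_covAlong_indConn hD hf hS hY hZ (X u)
  obtain ⟨b, hb⟩ := hp.exists_covAlong_indConn hD hf hS hX hZ (Y u)
  have hunfold : indCurv g D f S X Y Z u =
      hpu.tanProj hf hS (covAlong D f (pushAlong F f (indConn g D f S Y Z)) u (X u))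
        - hpu.tanProj hf hS (covAlong D f (pushAlong F f (indConn g D f S X Z)) u (Y u))
        - hpu.tanProj hf hS (covAlong D f (pushAlong F f Z) u (mlieBracket 𝓘(ℝ, E) X Y u)) := rfl
  have hn : hpu.tanProj hf hS (n u) = 0 := hpu.tanPart_transversal hf hS
  have hdf (x : TangentSpace 𝓘(ℝ, E) u) : hpu.tanProj hf hS (mfderiv% f u x) = x :=
    hpu.tanPart_mfderiv hf hS x
  have hshape (x : TangentSpace 𝓘(ℝ, E) u) :
      shapeOp g D f S n u x = -hpu.tanProj hf hS (covAlong D f n u x) := rfl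
  have htan := congrArg (hpu.tanProj hf hS) hcurv
  simp only [map_sub, map_smul, pushAlong, hdf] at htan
  rw [hunfold, ha, hb, hshape, hshape]
  simp only [map_add, map_sub, map_smul, hn, indMetric]
  linear_combination (norm := module) htan

end GaussEquation

section ConstantCurvature

variable [IsManifold 𝓘(ℝ, E) ∞ M] [IsManifold 𝓘(ℝ, F) ∞ N]

/-- The pair symmetry `R(X, Y, Z, W) = R(Z, W, X, Y)` of the induced curvature tensor, the part of
admissibility that forces the second fundamental form to vanish. -/
def HasPairSymmetricCurvature (g : SemiRiemannianMetric F N) (D : Connection F N) (f : M → N)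
    (S : Π u : M, Submodule ℝ (TangentSpace 𝓘(ℝ, E) u)) : Prop :=
  ∀ X Y Z W : VField E M, SmoothField X → SmoothField Y → SmoothField Z → SmoothField W →
    indCurv4 g D f S X Y Z W = indCurv4 g D f S Z W X Y

/-- The hypersurface is totally geodesic: its second fundamental form vanishes, that is, the
derivative of a tangential field is the induced one, with no transversal component. -/
def IsTotallyGeodesic (g : SemiRiemannianMetric F N) (D : Connection F N) (f : M → N)
    (S : Π u : M, Submodule ℝ (TangentSpace 𝓘(ℝ, E) u)) : Prop :=
  ∀ (u : M) (Y Z : VField E M), SmoothFieldNear Y u → SmoothFieldNear Z u →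
    mfderiv% f u (indConn g D f S Y Z u) = covAlong D f (pushAlong F f Z) u (Y u)

/-- The induced curvature operator is that of a space of constant curvature `c`. -/
def HasConstantIndCurv (g : SemiRiemannianMetric F N) (D : Connection F N) (f : M → N)
    (S : Π u : M, Submodule ℝ (TangentSpace 𝓘(ℝ, E) u)) (c : ℝ) : Prop :=
  ∀ (u : M) (X Y Z : VField E M), SmoothFieldNear X u → SmoothFieldNear Y u →
    SmoothFieldNear Z u → indCurv g D f S X Y Z u =
      c • (indMetric g f u (Y u) (Z u) • X u - indMetric g f u (X u) (Z u) • Y u)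

variable {g : SemiRiemannianMetric F N} {D : Connection F N} {f : M → N}
  {S : Π u : M, Submodule ℝ (TangentSpace 𝓘(ℝ, E) u)} {u : M} {c : ℝ}
  {ξ : VField E M} {n : Π u : M, TangentSpace 𝓘(ℝ, F) (f u)} {V₁ V₂ X Y Z W : VField E M}

lemma IsLightlikeHypersurface.smoothNear_indMetric (hf : IsLightlikeHypersurface (E := E) g f)
    (hX : SmoothFieldNear X u) (hY : SmoothFieldNear Y u) :
    SmoothNear 𝓘(ℝ, E) 𝓘(ℝ, ℝ) (fun x => indMetric g f x (X x) (Y x)) u :=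
  (hf.smoothAlongNear_pushAlong hX).metric g (hf.smoothAlongNear_pushAlong hY)

lemma HasConstantIndCurv.smooth_indCurv (hR : HasConstantIndCurv g D f S c)
    (hf : IsLightlikeHypersurface (E := E) g f) (hX : SmoothFieldNear X u)
    (hY : SmoothFieldNear Y u) (hZ : SmoothFieldNear Z u) :
    SmoothFieldNear (indCurv g D f S X Y Z) u := by
  filter_upwards [hX.eventually, hY.eventually, hZ.eventually] with x hXx hYx hZx
  have hgX := (hf.smoothNear_indMetric hYx hZx).contMDiffAt.smul_section hXx.contMDiffAt
  have hgY := (hf.smoothNear_indMetric hXx hZx).contMDiffAt.smul_section hYx.contMDiffAt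
  refine ((hgX.sub_section hgY).const_smul_section (a := c)).congr_of_eventuallyEq ?_
  filter_upwards [hXx.eventually, hYx.eventually, hZx.eventually] with y hXy hYy hZy
  exact congrArg (TotalSpace.mk' E y) (hR y X Y Z hXy hYy hZy)

lemma HasConstantIndCurv.indCurv4_eq (hR : HasConstantIndCurv g D f S c)
    (hX : SmoothFieldNear X u) (hY : SmoothFieldNear Y u) (hZ : SmoothFieldNear Z u)
    (W : VField E M) : indCurv4 g D f S X Y Z W u =
      c * (indMetric g f u (Y u) (Z u) * indMetric g f u (X u) (W u)
        - indMetric g f u (X u) (Z u) * indMetric g f u (Y u) (W u)) := by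
  rw [indCurv4, hR u X Y Z hX hY hZ]
  simp only [indMetric, map_smul, map_sub, smul_apply, sub_apply, smul_eq_mul]

lemma HasConstantIndCurv.indMetric_indCurv_left (hR : HasConstantIndCurv g D f S c)
    (hV₁ : SmoothFieldNear V₁ u) (hV₂ : SmoothFieldNear V₂ u) (hX : SmoothFieldNear X u)
    (hY : SmoothFieldNear Y u) :
    indMetric g f u (indCurv g D f S V₁ V₂ X u) (Y u) =
      -indMetric g f u (X u) (indCurv g D f S V₁ V₂ Y u) := by
  have hsymm (x y : TangentSpace 𝓘(ℝ, E) u) : indMetric g f u x y = indMetric g f u y x :=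
    g.symm _ _ _
  have hXY := hR.indCurv4_eq hV₁ hV₂ hX Y
  have hYX := hR.indCurv4_eq hV₁ hV₂ hY X
  rw [indCurv4] at hXY hYX
  rw [hsymm (X u), hXY, hYX]
  ring

theorem HasConstantIndCurv.isSemiSymmetric (hR : HasConstantIndCurv g D f S c)
    (hf : IsLightlikeHypersurface (E := E) g f) : IsSemiSymmetric g D f S := by
  intro V₁ V₂ X Y Z T hV₁ hV₂ hX hY hZ hT
  ext1 u
  replace hV₁ := hV₁.near u
  replace hV₂ := hV₂.near u
  replace hX := hX.near u
  replace hY := hY.near u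
  replace hZ := hZ.near u
  replace hT := hT.near u
  simp only [Pi.sub_apply, Pi.neg_apply, Pi.zero_apply]
  rw [hR.indCurv4_eq (hR.smooth_indCurv hf hV₁ hV₂ hX) hY hZ,
    hR.indCurv4_eq hX (hR.smooth_indCurv hf hV₁ hV₂ hY) hZ,
    hR.indCurv4_eq hX hY (hR.smooth_indCurv hf hV₁ hV₂ hZ), hR.indCurv4_eq hX hY hZ,
    hR.indMetric_indCurv_left hV₁ hV₂ hX hT, hR.indMetric_indCurv_left hV₁ hV₂ hX hZ,
    hR.indMetric_indCurv_left hV₁ hV₂ hY hT, hR.indMetric_indCurv_left hV₁ hV₂ hY hZ]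
  ring

variable [FiniteDimensional ℝ E] [FiniteDimensional ℝ F] [T2Space N]

theorem IsNormalizingPairNear.secondForm_eq_zero [T2Space M] (hD : IsLeviCivita g D)
    (hc : HasConstantSectionalCurvature g D c) (hf : IsLightlikeHypersurface (E := E) g f)
    (hS : IsScreen g f S) (hpair : HasPairSymmetricCurvature g D f S)
    (hp : IsNormalizingPairNear g f S ξ n u)
    (hA : indMetric g f u (shapeOp g D f S n u (ξ u)) (shapeOp g D f S n u (ξ u)) ≠ 0)
    (hY : SmoothFieldNear Y u) (hZ : SmoothFieldNear Z u) :
    secondForm g D f ξ Y Z u = 0 := by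
  obtain ⟨ξ', hξ', hξξ', hp'⟩ := hp.exists_smoothField
  obtain ⟨Y', hY', hYY'⟩ := hY.exists_smoothField
  obtain ⟨Z', hZ', hZZ'⟩ := hZ.exists_smoothField
  obtain ⟨W, hW, hWu⟩ := exists_smoothField_eq (shapeOp g D f S n u (ξ u))
  have hB : secondForm g D f ξ' Y' Z' u = secondForm g D f ξ Y Z u := by
    rw [secondForm_congr hYY' hZZ', secondForm, secondForm, pushAlong, pushAlong, hξξ']
  have hleft (x : TangentSpace 𝓘(ℝ, E) u) : indMetric g f u (ξ' u) x = 0 :=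
    hp'.pair.self_of_nhds.mem_radical x
  have hright (x : TangentSpace 𝓘(ℝ, E) u) : indMetric g f u x (ξ' u) = 0 :=
    (g.symm _ _ _).trans (hleft x)
  have hRξ : indCurv4 g D f S ξ' Y' Z' W u = secondForm g D f ξ Y Z u *
      indMetric g f u (shapeOp g D f S n u (ξ u)) (shapeOp g D f S n u (ξ u)) := by
    rw [indCurv4, hp'.gauss_equation hD hc hf hS (hξ'.near u) (hY'.near u) (hZ'.near u),
      hp'.secondForm_radical_left hD hf (hZ'.near u), hleft, hB, hWu, hξξ', zero_smul, zero_smul,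
      sub_zero, sub_zero]
    have hξW := hleft (shapeOp g D f S n u (ξ u))
    rw [hξξ'] at hξW
    simp only [indMetric, map_add, map_smul, add_apply, smul_apply, smul_eq_mul] at hξW ⊢
    rw [hξW, mul_zero, mul_zero, zero_add]
  have hRξ' : indCurv4 g D f S Z' W ξ' Y' u = 0 := by
    rw [indCurv4, hp'.gauss_equation hD hc hf hS (hZ'.near u) (hW.near u) (hξ'.near u),
      hp'.secondForm_radical_right hD hf, hp'.secondForm_radical_right hD hf, hright, hright]
    simp [indMetric]
  rw [hpair ξ' Y' Z' W hξ' hY' hZ' hW, hRξ'] at hRξ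
  exact (mul_eq_zero.1 hRξ.symm).resolve_right hA

section ShapeXiNonNull

variable [T2Space M] (hD : IsLeviCivita g D) (hc : HasConstantSectionalCurvature g D c)
  (hf : IsLightlikeHypersurface (E := E) g f) (hS : IsScreen g f S)
  (hpair : HasPairSymmetricCurvature g D f S) (hA : ShapeXiNonNull g D f S)
include hD hc hf hS hpair hA

theorem isTotallyGeodesic_of_shapeXiNonNull : IsTotallyGeodesic g D f S := by
  intro u Y Z hY hZ
  obtain ⟨ξ, n, hp, hne⟩ := hA.exists_near u
  rw [hp.pair.self_of_nhds.pushAlong_indConn hf hS,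
    hp.secondForm_eq_zero hD hc hf hS hpair hne hY hZ, zero_smul, sub_zero]

theorem hasConstantIndCurv_of_shapeXiNonNull : HasConstantIndCurv g D f S c := by
  intro u X Y Z hX hY hZ
  obtain ⟨ξ, n, hp, hne⟩ := hA.exists_near u
  rw [hp.gauss_equation hD hc hf hS hX hY hZ,
    hp.secondForm_eq_zero hD hc hf hS hpair hne hX hZ,
    hp.secondForm_eq_zero hD hc hf hS hpair hne hY hZ, zero_smul, zero_smul, add_zero, sub_zero]

end ShapeXiNonNull

section TotallyGeodesic

variable (hG : IsTotallyGeodesic g D f S) (hf : IsLightlikeHypersurface (E := E) g f)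
include hG hf

lemma IsTotallyGeodesic.smooth_indConn (hD : IsLeviCivita g D) (hX : SmoothFieldNear X u)
    (hY : SmoothFieldNear Y u) : SmoothFieldNear (indConn g D f S X Y) u := by
  have hdfY := hf.smoothAlongNear_pushAlong hY
  refine SmoothFieldNear.of_pushAlong (hf.immersion u)
    ((SmoothAlongNear.covAlong_apply hD.smooth hX hdfY (hf.immersion u)).congr ?_)
  filter_upwards [hX.eventually, hY.eventually] with x hXx hYx
  exact (hG x X Y hXx hYx).symm

lemma IsTotallyGeodesic.mvfderiv_indMetric (hD : IsLeviCivita g D) (hW : SmoothFieldNear W u)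
    (hX : SmoothFieldNear X u) (hY : SmoothFieldNear Y u) :
    d% (fun x => indMetric g f x (X x) (Y x)) u (W u) =
      indMetric g f u (indConn g D f S W X u) (Y u)
        + indMetric g f u (X u) (indConn g D f S W Y u) := by
  rw [indMetric, indMetric, hG u W X hW hX, hG u W Y hW hY]
  exact mvfderiv_metric hD (hf.smoothAlongNear_pushAlong hX) (hf.smoothAlongNear_pushAlong hY)
    (hf.immersion u) (W u)

lemma IsTotallyGeodesic.covAlong_indMetric_smul (hD : IsLeviCivita g D)
    (hW : SmoothFieldNear W u) (hX : SmoothFieldNear X u) (hY : SmoothFieldNear Y u)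
    (hZ : SmoothFieldNear Z u) (t : ℝ) :
    covAlong D f ((fun x => t * indMetric g f x (Y x) (Z x)) • pushAlong F f X) u (W u) =
      mfderiv% f u (t • ((indMetric g f u (indConn g D f S W Y u) (Z u)
          + indMetric g f u (Y u) (indConn g D f S W Z u)) • X u
        + indMetric g f u (Y u) (Z u) • indConn g D f S W X u)) := by
  have hYZ := (hf.smoothNear_indMetric hY hZ).mdifferentiableAt
  have ht : MDiffAt (fun _ : M => t) u := mdifferentiableAt_const
  have htYZ : MDiffAt (fun x => t * indMetric g f x (Y x) (Z x)) u := ht.mul hYZ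
  have hderiv : d% (fun x => t * indMetric g f x (Y x) (Z x)) u (W u) =
      t * (indMetric g f u (indConn g D f S W Y u) (Z u)
        + indMetric g f u (Y u) (indConn g D f S W Z u)) := by
    rw [mvfderiv_fun_mul ht hYZ, mvfderiv_const, smul_zero, add_zero, smul_apply,
      hG.mvfderiv_indMetric hf hD hW hY hZ, smul_eq_mul]
  rw [covAlong_smul htYZ (hf.smoothAlongNear_pushAlong hX)
    (hf.immersion u), hderiv, ← hG u W X hW hX]
  simp only [pushAlong, map_smul, map_add]
  module

lemma IsTotallyGeodesic.indConn_indCurv (hR : HasConstantIndCurv g D f S c)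
    (hD : IsLeviCivita g D) (hW : SmoothFieldNear W u) (hX : SmoothFieldNear X u)
    (hY : SmoothFieldNear Y u) (hZ : SmoothFieldNear Z u) :
    indConn g D f S W (indCurv g D f S X Y Z) u =
      c • ((indMetric g f u (indConn g D f S W Y u) (Z u)
          + indMetric g f u (Y u) (indConn g D f S W Z u)) • X u
        + indMetric g f u (Y u) (Z u) • indConn g D f S W X u)
      + -c • ((indMetric g f u (indConn g D f S W X u) (Z u)
          + indMetric g f u (X u) (indConn g D f S W Z u)) • Y u
        + indMetric g f u (X u) (Z u) • indConn g D f S W Y u) := by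
  have smooth_smul {A B : VField E M} (hA : SmoothFieldNear A u) (hB : SmoothFieldNear B u)
      (t : ℝ) : SmoothAlongNear E f
        ((fun x => t * indMetric g f x (B x) (Z x)) • pushAlong F f A) u :=
    SmoothAlongNear.smul (hf.smoothAlongNear_pushAlong hA)
      ((hf.smoothNear_indMetric hB hZ).mono fun x hx => contMDiffAt_const.mul hx)
  have hcurv : ∀ᶠ x in 𝓝 u, pushAlong F f (indCurv g D f S X Y Z) x =
      ((fun x => c * indMetric g f x (Y x) (Z x)) • pushAlong F f X
        + (fun x => -c * indMetric g f x (X x) (Z x)) • pushAlong F f Y) x := by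
    filter_upwards [hX.eventually, hY.eventually, hZ.eventually] with x hXx hYx hZx
    rw [pushAlong, hR x X Y Z hXx hYx hZx, Pi.add_apply, Pi.smul_apply', Pi.smul_apply']
    simp only [pushAlong, map_smul, map_sub]
    module
  refine hf.immersion u ?_
  rw [hG u W _ hW (hR.smooth_indCurv hf hX hY hZ), covAlong_congr hcurv,
    covAlong_add (smooth_smul hX hY c) (smooth_smul hY hX (-c)) (hf.immersion u),
    hG.covAlong_indMetric_smul hf hD hW hX hY hZ, hG.covAlong_indMetric_smul hf hD hW hY hX hZ,
    ← map_add]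

theorem IsTotallyGeodesic.isLocallySymmetric (hR : HasConstantIndCurv g D f S c)
    (hD : IsLeviCivita g D) : IsLocallySymmetric g D f S := by
  intro W X Y Z hW hX hY hZ
  ext1 u
  replace hW := hW.near u
  replace hX := hX.near u
  replace hY := hY.near u
  replace hZ := hZ.near u
  simp only [Pi.sub_apply, Pi.zero_apply]
  rw [hG.indConn_indCurv hf hR hD hW hX hY hZ,
    hR u _ Y Z (hG.smooth_indConn hf hD hW hX) hY hZ,
    hR u X _ Z hX (hG.smooth_indConn hf hD hW hY) hZ,
    hR u X Y _ hX hY (hG.smooth_indConn hf hD hW hZ)]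
  module

end TotallyGeodesic

end ConstantCurvature

end LightlikeGeometry

end

theorem corollary5p4_general
    {E : Type*} [NormedAddCommGroup E] [NormedSpace ℝ E] [FiniteDimensional ℝ E]
    {M : Type*} [TopologicalSpace M] [T2Space M] [ChartedSpace E M]
    [IsManifold 𝓘(ℝ, E) ∞ M]
    {F : Type*} [NormedAddCommGroup F] [NormedSpace ℝ F] [FiniteDimensional ℝ F]
    {N : Type*} [TopologicalSpace N] [T2Space N] [ChartedSpace F N]
    [IsManifold 𝓘(ℝ, F) ∞ N]
    (g : LightlikeGeometry.SemiRiemannianMetric F N)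
    (D : LightlikeGeometry.Connection F N) (hD : LightlikeGeometry.IsLeviCivita g D)
    (c : ℝ) (hc : LightlikeGeometry.HasConstantSectionalCurvature g D c)
    (f : M → N) (hf : LightlikeGeometry.IsLightlikeHypersurface (E := E) g f)
    (S : Π u : M, Submodule ℝ (TangentSpace 𝓘(ℝ, E) u))
    (hS : LightlikeGeometry.IsScreen g f S)
    (hpair : LightlikeGeometry.HasPairSymmetricCurvature g D f S)
    (hA : LightlikeGeometry.ShapeXiNonNull g D f S) :
    LightlikeGeometry.IsLocallySymmetric g D f S ∧
      LightlikeGeometry.IsSemiSymmetric g D f S := by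
  have hG := LightlikeGeometry.isTotallyGeodesic_of_shapeXiNonNull hD hc hf hS hpair hA
  have hR := LightlikeGeometry.hasConstantIndCurv_of_shapeXiNonNull hD hc hf hS hpair hA
  exact ⟨hG.isLocallySymmetric hf hR hD, hR.isSemiSymmetric hf⟩

theorem corollary5p4
    {E : Type*} [NormedAddCommGroup E] [NormedSpace ℝ E] [FiniteDimensional ℝ E]
    {M : Type*} [TopologicalSpace M] [T2Space M] [ChartedSpace E M]
    [IsManifold 𝓘(ℝ, E) ∞ M]
    {F : Type*} [NormedAddCommGroup F] [NormedSpace ℝ F] [FiniteDimensional ℝ F]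
    {N : Type*} [TopologicalSpace N] [T2Space N] [ChartedSpace F N]
    [IsManifold 𝓘(ℝ, F) ∞ N]
    (g : LightlikeGeometry.SemiRiemannianMetric F N)
    (D : LightlikeGeometry.Connection F N) (hD : LightlikeGeometry.IsLeviCivita g D)
    (c : ℝ) (hc : LightlikeGeometry.HasConstantSectionalCurvature g D c)
    (f : M → N) (hf : LightlikeGeometry.IsLightlikeHypersurface (E := E) g f)
    (hO : LightlikeGeometry.IsPointwiseOsserman (E := E) g D f)
    (S : Π u : M, Submodule ℝ (TangentSpace 𝓘(ℝ, E) u))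
    (hS : LightlikeGeometry.IsAdmissible g D f S)
    (hA : LightlikeGeometry.ShapeXiNonNull g D f S) :
    LightlikeGeometry.IsLocallySymmetric g D f S ↔
      LightlikeGeometry.IsSemiSymmetric g D f S := by
  obtain ⟨hlocally, hsemi⟩ :=
    corollary5p4_general g D hD c hc f hf S hS.isScreen hS.pair_symm hA
  exact iff_of_true hlocally hsemi
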